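/- For $j\in\{1,2,3\}$ let $S^j$ be the spin-$\tfrac12$ matrices on $\mathbb C^2$ and $S_x^j$ the operator acting as $S^j$ at site $x$ of a finite chain. For $\Delta>1$ and a finite chain $\Lambda=\{m,m+1,\dots,m+L-1\}\subset\mathbb Z$ define on $\mathcal H_\Lambda=(\mathbb C^2)^{\otimes L}$ the XXZ kink Hamiltonian $H_0=\sum_{x=m}^{m+L-2}h_{x,x+1}$, where $$h_{x,x+1}=-\Delta^{-1}\bigl(S_x^1S_{x+1}^1+S_x^2S_{x+1}^2\bigr)-S_x^3S_{x+1}^3+\tfrac12\sqrt{1-\Delta^{-2}}\,\bigl(S_x^3-S_{x+1}^3\bigr)+\tfrac14 .$$ For a magnetic field $\mathbf B:\mathbb Z\to\mathbb R^3$ let $H_V=H_0+V$ with $V=\sum_{x\in\Lambda}\mathbf B(x)\cdot\mathbf S_x$. **Theorem.** Assume that (A1) the support $\{x:\mathbf B(x)\neq 0\}$ is finite and non-empty and is an interval $\{a,a+1,\dots,b\}$ of $\mathbb Z$ (and $\mathbf B$ does not depend on the chain); (A2) for every $x$ in the support, $\mathbf B(x)\neq(0,0,\pm\|\mathbf B(x)\|)$,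 that is, $\mathbf B(x)$ has a nonzero component in the $xy$-plane. Then there is a finite $\Delta_0=\Delta_0(\mathbf B)\ge 1$ such that for every $\Delta>\Delta_0$ there is a $\gamma=\gamma(\Delta)>0$, independent of the length $L$ and of the position $m$ of the chain, such that for every finite chain $\Lambda$ that contains the support of $\mathbf B$: 1. $H_V$ has a unique ground state (its smallest eigenvalue $E_0$ is non-degenerate); 2. $\langle\psi,(H_V-E_0)\psi\rangle\ge\gamma\,\|\psi\|^2$ for every $\psi\in\mathcal H_\Lambda$ orthogonal to the ground state. -/

import Mathlib

open scoped InnerProductSpace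

noncomputable section

namespace XXZKink

/-- The spin-1/2 matrices `S¹, S², S³` (indexed by `0, 1, 2`); the basis vector `0` of `ℂ²` is
spin up and the basis vector `1` is spin down. -/
def spin : Fin 3 → Matrix (Fin 2) (Fin 2) ℂ :=
  ![!![0, 1 / 2; 1 / 2, 0],
    !![0, -Complex.I / 2; Complex.I / 2, 0],
    !![1 / 2, 0; 0, -1 / 2]]

/-- Spin configurations of `L` sites: the product basis of `(ℂ²)^{⊗ L} = ℂ^{2^L}`. -/
abbrev Config (L : ℕ) : Type := Fin L → Fin 2

/-- The Hilbert space `(ℂ²)^{⊗ L}` of a chain of `L` sites. -/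
abbrev Space (L : ℕ) : Type := EuclideanSpace ℂ (Config L)

/-- The operators on the Hilbert space, as matrices in the product basis. -/
abbrev Op (L : ℕ) : Type := Matrix (Config L) (Config L) ℂ

/-- The one-site operator `1 ⊗ ⋯ ⊗ A ⊗ ⋯ ⊗ 1` with `A` at site `x`. -/
def siteOp {L : ℕ} (A : Matrix (Fin 2) (Fin 2) ℂ) (x : Fin L) : Op L :=
  Matrix.of fun σ τ => if ∀ y, y ≠ x → σ y = τ y then A (σ x) (τ x) else 0

/-- The spin operator `S_x^{j+1}`. -/
def S {L : ℕ} (j : Fin 3) (x : Fin L) : Op L := siteOp (spin j) x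

/-- The nearest-neighbour kink interaction
`h_{x,y} = -Δ⁻¹ (S¹_x S¹_y + S²_x S²_y) - S³_x S³_y + (1/2) √(1 - Δ⁻²) (S³_x - S³_y) + 1/4`. -/
def bond {L : ℕ} (Δ : ℝ) (x y : Fin L) : Op L :=
  -((Δ⁻¹ : ℝ) : ℂ) • (S 0 x * S 0 y + S 1 x * S 1 y) - S 2 x * S 2 y
    + ((1 / 2 * Real.sqrt (1 - (Δ ^ 2)⁻¹) : ℝ) : ℂ) • (S 2 x - S 2 y)
    + (1 / 4 : ℂ) • (1 : Op L)

/-- The XXZ kink Hamiltonian `H₀ = ∑_x h_{x,x+1}`, the sum over the `L - 1` bonds of the chain. -/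
def H0 (L : ℕ) (Δ : ℝ) : Op L :=
  ∑ x : Fin L, if h : (x : ℕ) + 1 < L then bond Δ x ⟨(x : ℕ) + 1, h⟩ else 0

/-- The set of sites `{m, …, m + L - 1}` of the chain of length `L` whose first site is `m`. -/
def chain (m : ℤ) (L : ℕ) : Set ℤ := Set.Ico m (m + L)

/-- `V = ∑_x B(x) · S_x` on the chain `{m, …, m + L - 1}`: the element `x` of `Fin L` is the
site `m + x`. -/
def V (B : ℤ → EuclideanSpace ℝ (Fin 3)) (m : ℤ) (L : ℕ) : Op L :=
  ∑ x : Fin L, ∑ j : Fin 3, ((B (m + (x : ℕ)) j : ℝ) : ℂ) • S j x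

/-- The Hamiltonian `H_V = H₀ + V` on the chain `{m, …, m + L - 1}`. -/
def HV (Δ : ℝ) (B : ℤ → EuclideanSpace ℝ (Fin 3)) (m : ℤ) (L : ℕ) : Op L :=
  H0 L Δ + V B m L

/-- The linear map on the Hilbert space given by a matrix. -/
abbrev act {L : ℕ} (H : Op L) : Space L →ₗ[ℂ] Space L := Matrix.toEuclideanLin H

/-- `E` is the ground state energy of the (Hermitian) `H`: its smallest eigenvalue. -/
def IsGroundEnergy {L : ℕ} (H : Op L) (E : ℝ) : Prop :=
  IsLeast {e : ℝ | Module.End.HasEigenvalue (act H) (e : ℂ)} E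

/-- Up to a scalar, the unit vector `Ω` is the only eigenvector of `H` for the ground state
energy `E`. -/
def IsUniqueGroundState {L : ℕ} (H : Op L) (E : ℝ) (Ω : Space L) : Prop :=
  IsGroundEnergy H E ∧ ‖Ω‖ = 1 ∧ Module.End.eigenspace (act H) (E : ℂ) = Submodule.span ℂ {Ω}

end XXZKink

end

open scoped InnerProductSpace

noncomputable section

namespace XXZKink

open Matrix

/-! ### Quadratic forms of finite matrices and Perron–Frobenius. -/

section Forms

variable {n : Type*} [Fintype n]

/-! As Δ → ∞ the kink Hamiltonian becomes diagonal: it counts the kinks, the bonds with an up spin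
followed by a down spin. In this limit the spins outside the support of B are conserved and matter
only through the kinks they force. All spins down on the left and up on the right force none; any
other arrangement costs at least a kink whenever the spin at one particular end of the support has
the wrong value (`kinks_glue_ge`).

On the support the limit Hamiltonian is a fixed finite matrix. Since every B(x) there has an
xy-component, this matrix is irreducible and, after a diagonal change of phases, has nonpositive
off-diagonal entries. By Perron–Frobenius its ground states vanish at no configuration
(`ne_zero_of_ground_field`). So the ground state is unique and a penalty at either end strictly
raises the lowest energy (`exists_ground_gap`). The limit therefore has the same gap bound E₁ - E₀
on every chain (`exists_chain_ground`).

At finite Δ the error is at most Δ⁻¹ per wall (antiparallel bond). Up-down and down-up walls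
alternate, so there are at most twice as many walls as kinks, plus one, and the error is relatively
bounded by the kink number uniformly in the length (`abs_energy_H0_sub_le`). Min-max with the limit
ground state as trial vector transfers the gap (`exists_ground_of_trial`). -/

/-- The quadratic form `⟨ψ, A ψ⟩`. -/
def energy (A : Matrix n n ℂ) (ψ : n → ℂ) : ℝ := (star ψ ⬝ᵥ A *ᵥ ψ).re

/-- The squared `ℓ²` norm. -/
def mass (ψ : n → ℂ) : ℝ := ∑ i, ‖ψ i‖ ^ 2

lemma mass_nonneg (ψ : n → ℂ) : 0 ≤ mass ψ := Finset.sum_nonneg fun _ _ => sq_nonneg _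

lemma mass_pos {ψ : n → ℂ} (h : ψ ≠ 0) : 0 < mass ψ := by
  obtain ⟨i, hi⟩ := Function.ne_iff.mp h
  exact Finset.sum_pos' (fun _ _ => sq_nonneg _) ⟨i, Finset.mem_univ _, by
    have := norm_pos_iff.mpr hi
    positivity⟩

lemma mass_smul (c : ℂ) (ψ : n → ℂ) : mass (c • ψ) = ‖c‖ ^ 2 * mass ψ := by
  simp [mass, Finset.mul_sum, mul_pow]

lemma continuous_mass : Continuous (mass : (n → ℂ) → ℝ) := by
  unfold mass
  fun_prop

lemma star_dotProduct_self (ψ : n → ℂ) : star ψ ⬝ᵥ ψ = (mass ψ : ℂ) := by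
  simp [dotProduct, mass, Complex.conj_mul']

lemma energy_add (A A' : Matrix n n ℂ) (ψ : n → ℂ) :
    energy (A + A') ψ = energy A ψ + energy A' ψ := by
  simp [energy, add_mulVec]

lemma energy_sum {ι : Type*} (s : Finset ι) (A : ι → Matrix n n ℂ) (ψ : n → ℂ) :
    energy (∑ i ∈ s, A i) ψ = ∑ i ∈ s, energy (A i) ψ := by
  simp [energy, sum_mulVec, dotProduct_sum]

lemma energy_smul_right (A : Matrix n n ℂ) (c : ℂ) (ψ : n → ℂ) :
    energy A (c • ψ) = ‖c‖ ^ 2 * energy A ψ := by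
  have : star (c • ψ) ⬝ᵥ A *ᵥ (c • ψ) = ((‖c‖ ^ 2 : ℝ) : ℂ) * (star ψ ⬝ᵥ A *ᵥ ψ) := by
    rw [star_smul, mulVec_smul, smul_dotProduct, dotProduct_smul, smul_smul, smul_eq_mul]
    congr 1
    simpa using Complex.conj_mul' c
  rw [energy, this, Complex.re_ofReal_mul, energy]

lemma continuous_energy (A : Matrix n n ℂ) : Continuous (energy A) := by
  unfold energy
  simp only [dotProduct, mulVec, Pi.star_apply]
  fun_prop

lemma energy_diagonal [DecidableEq n] (d : n → ℝ) (ψ : n → ℂ) :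
    energy (diagonal fun i => (d i : ℂ)) ψ = ∑ i, d i * ‖ψ i‖ ^ 2 := by
  simp only [energy, dotProduct, mulVec_diagonal, Pi.star_apply, Complex.re_sum]
  refine Finset.sum_congr rfl fun i _ => ?_
  have : star (ψ i) * ((d i : ℂ) * ψ i) = ((d i * ‖ψ i‖ ^ 2 : ℝ) : ℂ) := by
    have := Complex.conj_mul' (ψ i)
    push_cast
    rw [← this]
    simp only [RCLike.star_def]
    ring
  rw [this, Complex.ofReal_re]

lemma energy_eq_sum (A : Matrix n n ℂ) (ψ : n → ℂ) :
    energy A ψ = ∑ i, ∑ j, (star (ψ i) * A i j * ψ j).re := by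
  simp [energy, dotProduct, mulVec, Finset.mul_sum, Complex.re_sum, mul_assoc]

/-- The Rayleigh quotient attains its minimum on a nonzero subspace. -/
lemma exists_energy_min (A : Matrix n n ℂ) (K : Submodule ℂ (n → ℂ)) (hK : K ≠ ⊥) :
    ∃ (E : ℝ), ∃ ψ₀ ∈ K, mass ψ₀ = 1 ∧ energy A ψ₀ = E ∧ ∀ ψ ∈ K, E * mass ψ ≤ energy A ψ := by
  have normalize : ∀ ψ : n → ℂ, ψ ≠ 0 → mass (((Real.sqrt (mass ψ))⁻¹ : ℂ) • ψ) = 1 := by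
    intro ψ h
    have := mass_pos h
    rw [mass_smul, norm_inv, Complex.norm_real, Real.norm_eq_abs, inv_pow, sq_abs,
      Real.sq_sqrt this.le, inv_mul_cancel₀ this.ne']
  set s : Set (n → ℂ) := {ψ | ψ ∈ K ∧ mass ψ = 1} with hs
  have hcl : IsClosed s :=
    (Submodule.closed_of_finiteDimensional K).inter (isClosed_eq continuous_mass continuous_const)
  have hbd : Bornology.IsBounded s := by
    refine (Metric.isBounded_closedBall (x := (0 : n → ℂ)) (r := 1)).subset fun ψ hψ => ?_
    rw [mem_closedBall_zero_iff, pi_norm_le_iff_of_nonneg zero_le_one]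
    intro i
    have h1 : ‖ψ i‖ ^ 2 ≤ mass ψ :=
      Finset.single_le_sum (f := fun i => ‖ψ i‖ ^ 2) (fun _ _ => sq_nonneg _) (Finset.mem_univ i)
    rw [hψ.2] at h1
    exact (sq_le_one_iff₀ (norm_nonneg _)).mp h1
  have hne : s.Nonempty := by
    obtain ⟨ψ, hψ, h0⟩ := Submodule.exists_mem_ne_zero_of_ne_bot hK
    exact ⟨_, K.smul_mem _ hψ, normalize ψ h0⟩
  obtain ⟨ψ₀, h₀, hmin⟩ := (Metric.isCompact_of_isClosed_isBounded hcl hbd).exists_isMinOn hne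
    (continuous_energy A).continuousOn
  refine ⟨_, ψ₀, h₀.1, h₀.2, rfl, fun ψ hψ => ?_⟩
  by_cases h0 : ψ = 0
  · simp [h0, mass, energy]
  have := hmin (show _ ∈ s from ⟨K.smul_mem _ hψ, normalize ψ h0⟩)
  simp only [Set.mem_ofPred_eq, energy_smul_right, norm_inv, Complex.norm_real, Real.norm_eq_abs,
    inv_pow, sq_abs, Real.sq_sqrt (mass_nonneg ψ)] at this
  rwa [inv_mul_eq_div, le_div_iff₀ (mass_pos h0)] at this

/-- A form that exceeds `E` at every nonzero vector of a subspace exceeds it uniformly. -/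
lemma exists_gap_of_forall_lt (A : Matrix n n ℂ) (K : Submodule ℂ (n → ℂ)) (E : ℝ)
    (h : ∀ ψ ∈ K, ψ ≠ 0 → E * mass ψ < energy A ψ) :
    ∃ E' > E, ∀ ψ ∈ K, E' * mass ψ ≤ energy A ψ := by
  by_cases hK : K = ⊥
  · refine ⟨E + 1, by linarith, fun ψ hψ => ?_⟩
    rw [hK, Submodule.mem_bot] at hψ
    simp [hψ, mass, energy]
  obtain ⟨E', ψ₀, hψ₀, hm, he, hmin⟩ := exists_energy_min A K hK
  refine ⟨E', ?_, hmin⟩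
  have := h ψ₀ hψ₀ (by rintro rfl; simp [mass] at hm)
  rwa [hm, he, mul_one] at this

lemma exists_abs_energy_le (A : Matrix n n ℂ) :
    ∃ v : ℝ, 0 ≤ v ∧ ∀ ψ, |energy A ψ| ≤ v * mass ψ := by
  have aux : ∀ A : Matrix n n ℂ, ∃ E : ℝ, ∀ ψ, E * mass ψ ≤ energy A ψ := fun A => by
    by_cases h : (⊤ : Submodule ℂ (n → ℂ)) = ⊥
    · refine ⟨0, fun ψ => ?_⟩
      have : ψ ∈ (⊤ : Submodule ℂ (n → ℂ)) := trivial
      rw [h, Submodule.mem_bot] at this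
      simp [this, mass, energy]
    · obtain ⟨E, -, -, -, -, hE⟩ := exists_energy_min A ⊤ h
      exact ⟨E, fun ψ => hE ψ trivial⟩
  obtain ⟨E, hE⟩ := aux A
  obtain ⟨E', hE'⟩ := aux (-A)
  refine ⟨max 0 (max (-E) (-E')), le_max_left _ _, fun ψ => abs_le.mpr ⟨?_, ?_⟩⟩
  · have h := hE ψ
    have : -E ≤ max 0 (max (-E) (-E')) := (le_max_left _ _).trans (le_max_right _ _)
    nlinarith [mass_nonneg ψ]
  · have h := hE' ψ
    have h2 : energy (-A) ψ = -energy A ψ := by simp [energy, neg_mulVec]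
    have : -E' ≤ max 0 (max (-E) (-E')) := (le_max_right _ _).trans (le_max_right _ _)
    nlinarith [mass_nonneg ψ]

open scoped ComplexOrder in
/-- A vector that attains the minimum of the form of a Hermitian matrix is an eigenvector. -/
lemma mulVec_eq_of_energy_le [DecidableEq n] {A : Matrix n n ℂ} (hA : A.IsHermitian) {E : ℝ}
    (hE : ∀ ψ, E * mass ψ ≤ energy A ψ) {ψ : n → ℂ} (hψ : energy A ψ ≤ E * mass ψ) :
    A *ᵥ ψ = (E : ℂ) • ψ := by
  have hval : ∀ χ : n → ℂ,
      star χ ⬝ᵥ (A - (E : ℂ) • (1 : Matrix n n ℂ)) *ᵥ χ = ((energy A χ - E * mass χ : ℝ) : ℂ) := by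
    intro χ
    have him := hA.im_star_dotProduct_mulVec_self χ
    have : star χ ⬝ᵥ A *ᵥ χ = (energy A χ : ℂ) := Complex.ext rfl (by simpa using him)
    rw [sub_mulVec, smul_mulVec, one_mulVec, dotProduct_sub, dotProduct_smul, this,
      star_dotProduct_self]
    simp
  -- A null vector of the form of a positive semidefinite matrix lies in its kernel.
  have hps : (A - (E : ℂ) • (1 : Matrix n n ℂ)).PosSemidef := by
    refine PosSemidef.of_dotProduct_mulVec_nonneg (hA.sub ?_) fun χ => ?_
    · simp [IsHermitian, conjTranspose_smul]
    · rw [hval]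
      exact_mod_cast sub_nonneg.mpr (hE χ)
  have h0 := (hps.dotProduct_mulVec_zero_iff ψ).mp (by
    rw [hval]
    exact_mod_cast sub_eq_zero.mpr (le_antisymm hψ (hE ψ)))
  rw [sub_mulVec, smul_mulVec, one_mulVec] at h0
  exact sub_eq_zero.mp h0

/-- Perron–Frobenius: if a diagonal unitary makes all off-diagonal entries of an irreducible
Hermitian matrix nonpositive, then its ground states have no zero component. -/
lemma ne_zero_of_ground [DecidableEq n] {A : Matrix n n ℂ} (hA : A.IsHermitian) {u : n → ℂ}
    (hu : ∀ i, ‖u i‖ = 1)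
    (hsgn : ∀ i j, i ≠ j → star (u i) * A i j * u j = -(‖A i j‖ : ℂ))
    (hconn : ∀ s : Set n, s.Nonempty → (∀ i ∈ s, ∀ j, A i j ≠ 0 → j ∈ s) → s = Set.univ)
    {E : ℝ} (hE : ∀ ψ, E * mass ψ ≤ energy A ψ) {ψ : n → ℂ} (h0 : ψ ≠ 0)
    (hψ : energy A ψ ≤ E * mass ψ) (i : n) : ψ i ≠ 0 := by
  -- Replacing the components by their moduli, with the phases `u`, keeps the mass and does not
  -- raise the energy; hence χ is again a minimizer and so an eigenvector.
  set χ : n → ℂ := fun i => u i * ‖ψ i‖ with hχ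
  have hu2 : ∀ i, star (u i) * u i = 1 := fun i => by
    have := Complex.conj_mul' (u i)
    simpa [hu i] using this
  have hm : mass χ = mass ψ := by simp [mass, hχ, hu]
  have he : energy A χ ≤ energy A ψ := by
    rw [energy_eq_sum, energy_eq_sum]
    refine Finset.sum_le_sum fun i _ => Finset.sum_le_sum fun j _ => ?_
    by_cases hij : i = j
    · subst hij
      apply le_of_eq
      congr 1
      have h1 : star (χ i) * A i i * χ i = (star (u i) * u i) * (‖ψ i‖ ^ 2 : ℂ) * A i i := by
        simp only [hχ, star_mul', RCLike.star_def, Complex.conj_ofReal]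
        ring
      rw [h1, hu2, ← Complex.conj_mul']
      simp only [RCLike.star_def]
      ring
    · have h1 : star (χ i) * A i j * χ j = ((-(‖A i j‖ * ‖ψ i‖ * ‖ψ j‖) : ℝ) : ℂ) := by
        have : star (χ i) * A i j * χ j = (star (u i) * A i j * u j) * (‖ψ i‖ * ‖ψ j‖) := by
          simp only [hχ, star_mul', RCLike.star_def, Complex.conj_ofReal]
          ring
        rw [this, hsgn i j hij]
        push_cast
        ring
      rw [h1, Complex.ofReal_re]
      have h2 : ‖star (ψ i) * A i j * ψ j‖ = ‖A i j‖ * ‖ψ i‖ * ‖ψ j‖ := by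
        rw [norm_mul, norm_mul, norm_star]
        ring
      rw [← h2]
      exact (abs_le.mp (Complex.abs_re_le_norm _)).1
  have heig : A *ᵥ χ = (E : ℂ) • χ := mulVec_eq_of_energy_le hA hE (by rw [hm]; exact he.trans hψ)
  intro hi
  -- At a zero of ψ the eigenvalue equation for χ is a vanishing sum of nonpositive terms, so ψ
  -- vanishes at every neighbour; by irreducibility it vanishes everywhere.
  have huniv := hconn {i | ψ i = 0} ⟨i, hi⟩ fun i hi j hij => by
    have h1 : ∑ j, star (u i) * (A i j * χ j) = 0 := by
      have h2 := congrFun heig i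
      have h3 : ((E : ℂ) • χ) i = 0 := by
        simp [hχ, show ψ i = 0 from hi]
      rw [h3] at h2
      rw [← Finset.mul_sum]
      exact mul_eq_zero_of_right _ h2
    have h4 : ∀ j, star (u i) * (A i j * χ j) = ((-(‖A i j‖ * ‖ψ j‖) : ℝ) : ℂ) := fun j => by
      by_cases hij : i = j
      · subst hij
        simp [hχ, show ψ i = 0 from hi]
      · have : star (u i) * (A i j * χ j) = (star (u i) * A i j * u j) * ‖ψ j‖ := by
          simp only [hχ]
          ring
        rw [this, hsgn i j hij]
        push_cast
        ring
    simp only [h4] at h1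
    rw [← Complex.ofReal_sum, Complex.ofReal_eq_zero, Finset.sum_neg_distrib, neg_eq_zero,
      Finset.sum_eq_zero_iff_of_nonneg (fun _ _ => by positivity)] at h1
    have := h1 j (Finset.mem_univ j)
    rcases mul_eq_zero.mp this with h | h
    · exact absurd (norm_eq_zero.mp h) hij
    · exact norm_eq_zero.mp h
  exact h0 (funext fun j => (huniv ▸ Set.mem_univ j : j ∈ {i | ψ i = 0}))

/-- If all ground states have no zero component, the ground state is unique up to a scalar and
there is a gap above it; moreover a nonzero nonnegative diagonal term raises the ground state
energy. -/
lemma exists_ground_gap [DecidableEq n] [Nonempty n] {A : Matrix n n ℂ} (hA : A.IsHermitian)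
    (hne : ∀ E : ℝ, (∀ ψ, E * mass ψ ≤ energy A ψ) → ∀ ψ, ψ ≠ 0 → energy A ψ ≤ E * mass ψ →
      ∀ i, ψ i ≠ 0)
    {ι : Type*} [Finite ι] (p : ι → n → ℝ) (hp : ∀ k i, 0 ≤ p k i) (hp' : ∀ k, ∃ i, 0 < p k i) :
    ∃ (E₀ E₁ : ℝ) (φ : n → ℂ), E₀ < E₁ ∧ mass φ = 1 ∧ energy A φ = E₀ ∧
      (∀ ψ, star φ ⬝ᵥ ψ = 0 → E₁ * mass ψ ≤ energy A ψ) ∧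
      ∀ k ψ, E₁ * mass ψ ≤ energy A ψ + ∑ i, p k i * ‖ψ i‖ ^ 2 := by
  have htop : (⊤ : Submodule ℂ (n → ℂ)) ≠ ⊥ := top_ne_bot
  obtain ⟨E₀, φ, -, hm, he, hmin⟩ := exists_energy_min A ⊤ htop
  replace hmin : ∀ ψ, E₀ * mass ψ ≤ energy A ψ := fun ψ => hmin ψ trivial
  have hφ0 : φ ≠ 0 := by
    rintro rfl
    simp [mass] at hm
  have hφ := hne E₀ hmin φ hφ0 (by rw [hm, he, mul_one])
  have hφeig := mulVec_eq_of_energy_le hA hmin (ψ := φ) (by rw [hm, he, mul_one])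
  have h1 : ∃ E' > E₀, ∀ ψ, star φ ⬝ᵥ ψ = 0 → E' * mass ψ ≤ energy A ψ := by
    let K : Submodule ℂ (n → ℂ) :=
      { carrier := {ψ | star φ ⬝ᵥ ψ = 0}
        add_mem' := fun {a b} ha hb => by
          simp only [Set.mem_ofPred_eq] at *
          rw [dotProduct_add, ha, hb, add_zero]
        zero_mem' := by simp
        smul_mem' := fun c a ha => by
          simp only [Set.mem_ofPred_eq] at *
          rw [dotProduct_smul, ha, smul_zero] }
    refine exists_gap_of_forall_lt A K E₀ fun ψ hψ h0 => lt_of_not_ge fun hle => ?_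
    have hψeig := mulVec_eq_of_energy_le hA hmin hle
    obtain ⟨i⟩ := ‹Nonempty n›
    -- This combination of two ground states vanishes at `i`, so it is zero; pairing it with φ then
    -- gives `ψ i = 0`, which is impossible.
    set χ := φ i • ψ - ψ i • φ with hχ
    have hχeig : A *ᵥ χ = (E₀ : ℂ) • χ := by
      rw [hχ, mulVec_sub, mulVec_smul, mulVec_smul, hψeig, hφeig, smul_sub, smul_comm (φ i),
        smul_comm (ψ i)]
    have hχe : energy A χ ≤ E₀ * mass χ := by
      rw [energy, hχeig, dotProduct_smul, star_dotProduct_self]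
      simp
    have hχ0 : χ = 0 := by
      by_contra h
      refine hne E₀ hmin χ h hχe i ?_
      simp [hχ, mul_comm]
    have h2 : star φ ⬝ᵥ χ = - ψ i := by
      rw [hχ, dotProduct_sub, dotProduct_smul, dotProduct_smul, show star φ ⬝ᵥ ψ = 0 from hψ,
        star_dotProduct_self, hm]
      simp
    rw [hχ0, dotProduct_zero] at h2
    exact hne E₀ hmin ψ h0 hle i (by simpa using h2.symm)
  have h2 : ∀ k, ∃ E' > E₀, ∀ ψ, E' * mass ψ ≤ energy A ψ + ∑ i, p k i * ‖ψ i‖ ^ 2 := by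
    intro k
    obtain ⟨E', hE', h⟩ := exists_gap_of_forall_lt (A + diagonal fun i => (p k i : ℂ)) ⊤ E₀
      fun ψ _ h0 => by
        rw [energy_add, energy_diagonal]
        have hpn : ∀ i ∈ Finset.univ, 0 ≤ p k i * ‖ψ i‖ ^ 2 :=
          fun i _ => mul_nonneg (hp k i) (sq_nonneg _)
        -- Either ψ is a ground state, and the penalty is positive because no component vanishes, or
        -- its energy already exceeds E₀.
        by_cases hle : energy A ψ ≤ E₀ * mass ψ
        · obtain ⟨i, hi⟩ := hp' k
          have := Finset.sum_pos' hpn ⟨i, Finset.mem_univ _, mul_pos hi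
            (pow_pos (norm_pos_iff.mpr (hne E₀ hmin ψ h0 hle i)) 2)⟩
          linarith [hmin ψ]
        · linarith [Finset.sum_nonneg hpn]
    refine ⟨E', hE', fun ψ => ?_⟩
    rw [← energy_diagonal, ← energy_add]
    exact h ψ trivial
  obtain ⟨E', hE', h1⟩ := h1
  choose F hF h2 using h2
  obtain ⟨E₁, hE₁, hle⟩ : ∃ E₁ > E₀, E₁ ≤ E' ∧ ∀ k, E₁ ≤ F k := by
    rcases isEmpty_or_nonempty ι with hι | hι
    · exact ⟨E', hE', le_rfl, fun k => hι.elim k⟩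
    · obtain ⟨k₀, hk₀⟩ := Finite.exists_min F
      exact ⟨min E' (F k₀), lt_min hE' (hF k₀), min_le_left _ _,
        fun k => (min_le_right _ _).trans (hk₀ k)⟩
  exact ⟨E₀, E₁, φ, hE₁, hm, he,
    fun ψ hψ => (mul_le_mul_of_nonneg_right hle.1 (mass_nonneg ψ)).trans (h1 ψ hψ),
    fun k ψ => (mul_le_mul_of_nonneg_right (hle.2 k) (mass_nonneg ψ)).trans (h2 k ψ)⟩

end Forms

/-! ### Min-max with one trial vector. -/

section MinMax

variable {F : Type*} [NormedAddCommGroup F] [InnerProductSpace ℂ F] [FiniteDimensional ℂ F]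

/-- A gap of the quadratic form with respect to a trial vector `φ` yields a non-degenerate
smallest eigenvalue with a spectral gap. -/
lemma exists_ground_of_trial {T : F →ₗ[ℂ] F} (hT : T.IsSymmetric) {φ : F} {a b : ℝ} (hab : a < b)
    (hφ : ‖φ‖ = 1) (ha : (⟪φ, T φ⟫_ℂ).re ≤ a)
    (hb : ∀ ψ, ⟪φ, ψ⟫_ℂ = 0 → b * ‖ψ‖ ^ 2 ≤ (⟪ψ, T ψ⟫_ℂ).re) :
    ∃ (E : ℝ) (Ω : F), IsLeast {e : ℝ | Module.End.HasEigenvalue T (e : ℂ)} E ∧ ‖Ω‖ = 1 ∧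
      Module.End.eigenspace T (E : ℂ) = Submodule.span ℂ {Ω} ∧
      ∀ ψ, ⟪Ω, ψ⟫_ℂ = 0 → (b - a) * ‖ψ‖ ^ 2 ≤ (⟪ψ, T ψ - (E : ℂ) • ψ⟫_ℂ).re := by
  set e := hT.eigenvectorBasis rfl with he
  set l := hT.eigenvalues rfl with hl
  have hTe : ∀ i, T (e i) = (l i : ℂ) • e i := fun i => hT.apply_eigenvectorBasis rfl i
  have hform : ∀ ψ, (⟪ψ, T ψ⟫_ℂ).re = ∑ i, l i * ‖⟪e i, ψ⟫_ℂ‖ ^ 2 := by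
    intro ψ
    rw [← e.sum_inner_mul_inner, Complex.re_sum]
    refine Finset.sum_congr rfl fun i _ => ?_
    rw [← hT, hTe, inner_smul_left, Complex.conj_ofReal, ← inner_conj_symm ψ (e i)]
    have : (starRingEnd ℂ) ⟪e i, ψ⟫_ℂ * ((l i : ℂ) * ⟪e i, ψ⟫_ℂ)
        = ((l i * ‖⟪e i, ψ⟫_ℂ‖ ^ 2 : ℝ) : ℂ) := by
      push_cast
      rw [← Complex.conj_mul']
      ring
    rw [this, Complex.ofReal_re]
  have hnorm : ∀ ψ, ‖ψ‖ ^ 2 = ∑ i, ‖⟪e i, ψ⟫_ℂ‖ ^ 2 := fun ψ =>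
    (e.sum_sq_norm_inner_right ψ).symm
  have hne : Nonempty (Fin (Module.finrank ℂ F)) := by
    by_contra h
    rw [not_nonempty_iff] at h
    have := hnorm φ
    rw [hφ, Finset.univ_eq_empty, Finset.sum_empty] at this
    norm_num at this
  obtain ⟨i₀, hi₀⟩ := Finite.exists_min l
  have hlow : l i₀ ≤ a := by
    refine le_trans ?_ ha
    have := hnorm φ
    rw [hφ, one_pow] at this
    rw [hform, ← mul_one (l i₀), this, Finset.mul_sum]
    exact Finset.sum_le_sum fun i _ => mul_le_mul_of_nonneg_right (hi₀ i) (sq_nonneg _)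
  have horth : ∀ i j, ⟪e i, e j⟫_ℂ = if i = j then 1 else 0 :=
    orthonormal_iff_ite.mp e.orthonormal
  have hhigh : ∀ j, j ≠ i₀ → b ≤ l j := by
    intro j hj
    by_contra! hlt
    -- Were two eigenvalues below b, this vector of their span, orthogonal to φ, would contradict
    -- `hb` unless both coefficients vanish; then `e i₀` itself is orthogonal to φ and contradicts
    -- `hb`.
    set ψ := ⟪φ, e j⟫_ℂ • e i₀ - ⟪φ, e i₀⟫_ℂ • e j with hψ
    have hperp : ⟪φ, ψ⟫_ℂ = 0 := by
      rw [hψ, inner_sub_right, inner_smul_right, inner_smul_right]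
      ring
    have hTψ : (⟪ψ, T ψ⟫_ℂ).re = l i₀ * ‖⟪φ, e j⟫_ℂ‖ ^ 2 + l j * ‖⟪φ, e i₀⟫_ℂ‖ ^ 2 ∧
        ‖ψ‖ ^ 2 = ‖⟪φ, e j⟫_ℂ‖ ^ 2 + ‖⟪φ, e i₀⟫_ℂ‖ ^ 2 := by
      have h0 : ∀ i, ⟪e i, ψ⟫_ℂ = (if i = i₀ then ⟪φ, e j⟫_ℂ else 0)
          - (if i = j then ⟪φ, e i₀⟫_ℂ else 0) := fun i => by
        rw [hψ, inner_sub_right, inner_smul_right, inner_smul_right, horth, horth]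
        simp
      have h1 : ∀ i, ‖⟪e i, ψ⟫_ℂ‖ ^ 2 = (if i = i₀ then ‖⟪φ, e j⟫_ℂ‖ ^ 2 else 0)
          + (if i = j then ‖⟪φ, e i₀⟫_ℂ‖ ^ 2 else 0) := fun i => by
        rw [h0]
        by_cases h : i = i₀
        · subst h
          simp [hj.symm]
        · by_cases h' : i = j
          · subst h'
            simp [h]
          · simp [h, h']
      constructor
      · rw [hform]
        simp [h1, mul_add, Finset.sum_add_distrib]
      · rw [hnorm]
        simp [h1, Finset.sum_add_distrib]
    have h1 := hb ψ hperp
    rw [hTψ.1, hTψ.2] at h1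
    have h2 : l i₀ < b := hlow.trans_lt hab
    have hz1 : ‖⟪φ, e j⟫_ℂ‖ ^ 2 = 0 := by
      nlinarith [sq_nonneg ‖⟪φ, e j⟫_ℂ‖, sq_nonneg ‖⟪φ, e i₀⟫_ℂ‖]
    have hz2 : ‖⟪φ, e i₀⟫_ℂ‖ ^ 2 = 0 := by
      nlinarith [sq_nonneg ‖⟪φ, e j⟫_ℂ‖, sq_nonneg ‖⟪φ, e i₀⟫_ℂ‖]
    have hi₀φ : ⟪φ, e i₀⟫_ℂ = 0 := by simpa using hz2
    have := hb (e i₀) hi₀φ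
    rw [hTe, inner_smul_right, horth] at this
    simp only [e.norm_eq_one, if_true, mul_one, Complex.ofReal_re, one_pow] at this
    linarith
  have hgap : ∀ ψ, ⟪e i₀, ψ⟫_ℂ = 0 → b * ‖ψ‖ ^ 2 ≤ (⟪ψ, T ψ⟫_ℂ).re := by
    intro ψ hψ
    rw [hform, hnorm, Finset.mul_sum]
    refine Finset.sum_le_sum fun i _ => ?_
    by_cases h : i = i₀
    · simp [h, hψ]
    · exact mul_le_mul_of_nonneg_right (hhigh i h) (sq_nonneg _)
  have heig : Module.End.eigenspace T (l i₀ : ℂ) = Submodule.span ℂ {e i₀} := by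
    apply le_antisymm
    · intro ψ hψ
      rw [Module.End.mem_eigenspace_iff] at hψ
      set χ := ψ - ⟪e i₀, ψ⟫_ℂ • e i₀ with hχ
      have hperp : ⟪e i₀, χ⟫_ℂ = 0 := by
        rw [hχ, inner_sub_right, inner_smul_right, horth]
        simp
      have hTχ : T χ = (l i₀ : ℂ) • χ := by
        rw [hχ, map_sub, map_smul, hψ, hTe, smul_sub, smul_comm]
      have := hgap χ hperp
      rw [hTχ, inner_smul_right, inner_self_eq_norm_sq_to_K] at this
      have h2 : ((l i₀ : ℂ) * ((‖χ‖ : ℝ) : ℂ) ^ 2).re = l i₀ * ‖χ‖ ^ 2 := by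
        rw [← Complex.ofReal_pow, ← Complex.ofReal_mul, Complex.ofReal_re]
      have h3 : b * ‖χ‖ ^ 2 ≤ l i₀ * ‖χ‖ ^ 2 := h2 ▸ this
      have h4 : ‖χ‖ ^ 2 = 0 := by nlinarith [sq_nonneg ‖χ‖]
      have h5 : χ = 0 := by simpa using h4
      rw [Submodule.mem_span_singleton]
      exact ⟨_, (sub_eq_zero.mp h5).symm⟩
    · rw [Submodule.span_singleton_le_iff_mem, Module.End.mem_eigenspace_iff]
      exact hTe i₀
  refine ⟨l i₀, e i₀, ⟨?_, ?_⟩, e.norm_eq_one i₀, heig, fun ψ hψ => ?_⟩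
  · rw [Set.mem_ofPred_eq, Module.End.HasEigenvalue, Module.End.HasUnifEigenvalue]
    intro h
    have h2 : e i₀ ∈ Module.End.eigenspace T (l i₀ : ℂ) := by
      rw [Module.End.mem_eigenspace_iff]
      exact hTe i₀
    rw [Module.End.eigenspace, h, Submodule.mem_bot] at h2
    exact e.toBasis.ne_zero i₀ (by simpa using h2)
  · intro c hc
    obtain ⟨ψ, hψ⟩ := hc.exists_hasEigenvector
    have h1 : (⟪ψ, T ψ⟫_ℂ).re = c * ‖ψ‖ ^ 2 := by
      rw [hψ.apply_eq_smul, inner_smul_right, inner_self_eq_norm_sq_to_K]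
      exact (congrArg Complex.re (by push_cast; rfl)).trans (Complex.ofReal_re (c * ‖ψ‖ ^ 2))
    have h2 : l i₀ * ‖ψ‖ ^ 2 ≤ c * ‖ψ‖ ^ 2 := by
      rw [← h1, hform, hnorm, Finset.mul_sum]
      exact Finset.sum_le_sum fun i _ => mul_le_mul_of_nonneg_right (hi₀ i) (sq_nonneg _)
    exact le_of_mul_le_mul_right h2 (pow_pos (norm_pos_iff.mpr hψ.2) 2)
  · have h1 : (⟪ψ, (l i₀ : ℂ) • ψ⟫_ℂ).re = l i₀ * ‖ψ‖ ^ 2 := by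
      rw [inner_smul_right, inner_self_eq_norm_sq_to_K]
      exact (congrArg Complex.re (by push_cast; rfl)).trans (Complex.ofReal_re (l i₀ * ‖ψ‖ ^ 2))
    rw [inner_sub_right, Complex.sub_re, h1]
    nlinarith [hgap ψ hψ, sq_nonneg ‖ψ‖]

end MinMax

/-! ### One-site operators and hermiticity. -/

section SiteOperators

variable {L : ℕ}

lemma eq_update_of_agree {σ τ : Config L} {x : Fin L} (h : ∀ y, y ≠ x → σ y = τ y) :
    Function.update σ x (τ x) = τ := by
  ext y
  by_cases hy : y = x
  · subst hy
    simp
  · simp [hy, h y hy]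

lemma siteOp_mulVec (A : Matrix (Fin 2) (Fin 2) ℂ) (x : Fin L) (ψ : Config L → ℂ)
    (σ : Config L) :
    (siteOp A x *ᵥ ψ) σ = ∑ s, A (σ x) s * ψ (Function.update σ x s) := by
  symm
  refine Fintype.sum_of_injective (fun s => Function.update σ x s)
    (Function.update_injective σ x) _ (fun τ => siteOp A x σ τ * ψ τ) (fun τ hτ => ?_) fun s => ?_
  · have : ¬ ∀ y, y ≠ x → σ y = τ y := fun h => hτ ⟨τ x, eq_update_of_agree h⟩
    simp only [siteOp, of_apply, if_neg this, zero_mul]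
  · have : ∀ y, y ≠ x → σ y = Function.update σ x s y := fun y hy => by simp [hy]
    simp only [siteOp, of_apply, if_pos this, Function.update_self]

lemma siteOp_conjTranspose (A : Matrix (Fin 2) (Fin 2) ℂ) (x : Fin L) :
    (siteOp A x)ᴴ = siteOp Aᴴ x := by
  ext σ τ
  simp only [siteOp, conjTranspose_apply, of_apply, apply_ite star, star_zero, eq_comm]

lemma siteOp_commute (A A' : Matrix (Fin 2) (Fin 2) ℂ) {x y : Fin L} (h : x ≠ y) :
    siteOp A x * siteOp A' y = siteOp A' y * siteOp A x := by
  apply mulVec_injective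
  ext ψ σ
  simp only [← mulVec_mulVec, siteOp_mulVec, Finset.mul_sum, Function.update_of_ne h.symm,
    Function.update_of_ne h]
  rw [Finset.sum_comm]
  refine Finset.sum_congr rfl fun s _ => Finset.sum_congr rfl fun t _ => ?_
  rw [Function.update_comm h]
  ring

lemma spin_isHermitian (j : Fin 3) : (spin j).IsHermitian := by
  ext a b
  fin_cases j <;> fin_cases a <;> fin_cases b <;> simp [spin, conjTranspose_apply]

lemma S_isHermitian (j : Fin 3) (x : Fin L) : (S j x).IsHermitian := by
  rw [IsHermitian, S, siteOp_conjTranspose, spin_isHermitian]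

lemma S_mul_S_isHermitian (j : Fin 3) {x y : Fin L} (h : x ≠ y) :
    (S j x * S j y).IsHermitian := by
  rw [IsHermitian, conjTranspose_mul, S_isHermitian, S_isHermitian]
  exact siteOp_commute _ _ h.symm

lemma IsHermitian.real_smul {n : Type*} {A : Matrix n n ℂ} (hA : A.IsHermitian) (r : ℝ) :
    ((r : ℂ) • A).IsHermitian := by
  rw [IsHermitian, conjTranspose_smul, hA]
  simp

lemma bond_isHermitian (Δ : ℝ) {x y : Fin L} (h : x ≠ y) : (bond Δ x y).IsHermitian := by
  unfold bond
  rw [← Complex.ofReal_neg, show (1 / 4 : ℂ) = ((1 / 4 : ℝ) : ℂ) by norm_num]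
  exact (((IsHermitian.real_smul ((S_mul_S_isHermitian 0 h).add (S_mul_S_isHermitian 1 h)) _).sub
    (S_mul_S_isHermitian 2 h)).add (IsHermitian.real_smul
      ((S_isHermitian 2 x).sub (S_isHermitian 2 y)) _)).add
    (IsHermitian.real_smul isHermitian_one _)

lemma H0_succ (n : ℕ) (Δ : ℝ) :
    H0 (n + 1) Δ = ∑ x : Fin n, bond Δ x.castSucc x.succ := by
  rw [H0, Fin.sum_univ_castSucc]
  simp [Fin.succ]

lemma isHermitian_sum {n ι : Type*} (s : Finset ι) (A : ι → Matrix n n ℂ)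
    (h : ∀ i ∈ s, (A i).IsHermitian) : (∑ i ∈ s, A i).IsHermitian := by
  rw [IsHermitian, conjTranspose_sum]
  exact Finset.sum_congr rfl h

lemma H0_succ_isHermitian (n : ℕ) (Δ : ℝ) : (H0 (n + 1) Δ).IsHermitian := by
  rw [H0_succ]
  exact isHermitian_sum _ _ fun x _ => bond_isHermitian Δ (Fin.castSucc_lt_succ).ne

lemma V_isHermitian (B : ℤ → EuclideanSpace ℝ (Fin 3)) (m : ℤ) (L : ℕ) :
    (V B m L).IsHermitian :=
  isHermitian_sum _ _ fun x _ => isHermitian_sum _ _ fun j _ =>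
    IsHermitian.real_smul (S_isHermitian j x) _

end SiteOperators

/-! ### The bond interaction and its limit of infinite anisotropy. -/

section Bond

variable {L : ℕ}

lemma fin_two_cases (a : Fin 2) : a = 0 ∨ a = 1 := by
  omega

/-- On parallel spins the constant 1/4 cancels the S³S³ term and the rest vanishes. On antiparallel
spins S¹S¹ + S²S² is half the exchange of the two spins. -/
lemma bond_mulVec (Δ : ℝ) {x y : Fin L} (h : x ≠ y) (ψ : Config L → ℂ) (σ : Config L) :
    (bond Δ x y *ᵥ ψ) σ = if σ x = σ y then 0 else
      ((1 / 2 + (if σ x = 0 then 1 else -1) * (1 / 2 * Real.sqrt (1 - (Δ ^ 2)⁻¹)) : ℝ) : ℂ) * ψ σ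
        - ((1 / 2 * Δ⁻¹ : ℝ) : ℂ) * ψ (σ ∘ Equiv.swap x y) := by
  have hself : ∀ (z : Fin L) (s : Fin 2), σ z = s → Function.update σ z s = σ := by
    rintro z s rfl
    exact Function.update_eq_self z σ
  have hswap : Function.update (Function.update σ x (σ y)) y (σ x) = σ ∘ Equiv.swap x y := by
    ext z
    by_cases hzy : z = y
    · subst hzy
      simp
    · by_cases hzx : z = x
      · subst hzx
        simp [h]
      · simp [hzy, hzx, Equiv.swap_apply_of_ne_of_ne]
  have hs0 : spin 0 = !![0, 1 / 2; 1 / 2, 0] := rfl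
  have hs1 : spin 1 = !![0, -Complex.I / 2; Complex.I / 2, 0] := rfl
  have hs2 : spin 2 = !![1 / 2, 0; 0, -1 / 2] := rfl
  simp only [bond, add_mulVec, sub_mulVec, smul_mulVec, one_mulVec, ← mulVec_mulVec, S,
    Pi.add_apply, Pi.sub_apply, Pi.smul_apply, siteOp_mulVec, Fin.sum_univ_two,
    Function.update_of_ne h.symm, smul_eq_mul]
  rcases fin_two_cases (σ x) with hx | hx <;> rcases fin_two_cases (σ y) with hy | hy <;>
  · rw [hx, hy] at hswap
    have h1 := hself x _ hx
    have h2 := hself y _ hy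
    simp only [hx, hy, hs0, hs1, hs2, hswap, h1, h2]
    norm_num
    ring_nf
    try norm_num [Complex.I_sq]
    try ring_nf

/-- The root √(1 - Δ⁻²) lies between 1 - Δ⁻¹ and 1, so the diagonal entries are within Δ⁻¹/2 of
their limits 1 and 0, and the exchange has amplitude Δ⁻¹/2. Confining the error to antiparallel
spins is what later makes it uniform in the length. -/
lemma abs_energy_bond_sub_le {Δ : ℝ} (hΔ : 1 ≤ Δ) {x y : Fin L} (h : x ≠ y) (ψ : Config L → ℂ) :
    |energy (bond Δ x y) ψ - ∑ σ : Config L, (if σ x = 0 ∧ σ y = 1 then 1 else 0) * ‖ψ σ‖ ^ 2|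
      ≤ Δ⁻¹ * ∑ σ : Config L, (if σ x = σ y then 0 else 1) * ‖ψ σ‖ ^ 2 := by
  set r := Real.sqrt (1 - (Δ ^ 2)⁻¹) with hr
  set d := Δ⁻¹ with hd
  have hd0 : 0 < d := by positivity
  have hd1 : d ≤ 1 := inv_le_one_of_one_le₀ hΔ
  have hr1 : r ≤ 1 := Real.sqrt_le_one.mpr (by rw [sub_le_self_iff]; positivity)
  have hrd : 1 - d ≤ r := by
    apply Real.le_sqrt_of_sq_le
    rw [← inv_pow, ← hd]
    nlinarith
  have hsum : ∑ σ : Config L, (if σ x = σ y then 0 else 1) * ‖ψ (σ ∘ Equiv.swap x y)‖ ^ 2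
      = ∑ σ : Config L, (if σ x = σ y then 0 else 1) * ‖ψ σ‖ ^ 2 := by
    refine Fintype.sum_equiv ((Equiv.swap x y).arrowCongr (Equiv.refl _)) _ _ fun σ => ?_
    have : (Equiv.swap x y).arrowCongr (Equiv.refl (Fin 2)) σ = σ ∘ Equiv.swap x y := by
      ext z
      simp [Equiv.arrowCongr]
    rw [this]
    simp [eq_comm]
  -- The diagonal contributes d/2, and the exchange, by the arithmetic-geometric mean inequality,
  -- d/4 to each of σ and its swap. By `hsum` the weights 3/4 and 1/4 add up to 1.
  have key : ∀ σ : Config L, |(star (ψ σ) * (bond Δ x y *ᵥ ψ) σ).re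
        - (if σ x = 0 ∧ σ y = 1 then 1 else 0) * ‖ψ σ‖ ^ 2|
      ≤ (if σ x = σ y then 0 else 1) *
        (d * (3 / 4) * ‖ψ σ‖ ^ 2 + d / 4 * ‖ψ (σ ∘ Equiv.swap x y)‖ ^ 2) := by
    intro σ
    rw [bond_mulVec Δ h]
    by_cases hxy : σ x = σ y
    · have : ¬(σ x = 0 ∧ σ y = 1) := by
        rintro ⟨h0, h1⟩
        rw [h0, h1] at hxy
        exact absurd hxy (by decide)
      rw [if_neg this, if_pos hxy, if_pos hxy]
      simp
    · rw [if_neg hxy, if_neg hxy, one_mul]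
      have hre : ∀ c e : ℝ, (star (ψ σ) * ((c : ℂ) * ψ σ
          - (e : ℂ) * ψ (σ ∘ Equiv.swap x y))).re
          = c * ‖ψ σ‖ ^ 2 - e * (star (ψ σ) * ψ (σ ∘ Equiv.swap x y)).re := by
        intro c e
        have h1 : star (ψ σ) * ((c : ℂ) * ψ σ - (e : ℂ) * ψ (σ ∘ Equiv.swap x y))
            = ((c * ‖ψ σ‖ ^ 2 : ℝ) : ℂ) - (e : ℂ) * (star (ψ σ) * ψ (σ ∘ Equiv.swap x y)) := by
          push_cast
          rw [← Complex.conj_mul']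
          simp only [RCLike.star_def]
          ring
        rw [h1, Complex.sub_re, Complex.ofReal_re, Complex.re_ofReal_mul]
      rw [hre]
      have habs : |(star (ψ σ) * ψ (σ ∘ Equiv.swap x y)).re|
          ≤ ‖ψ σ‖ * ‖ψ (σ ∘ Equiv.swap x y)‖ := by
        refine (Complex.abs_re_le_norm _).trans ?_
        rw [norm_mul, norm_star]
      obtain ⟨ha1, ha2⟩ := abs_le.mp habs
      generalize (star (ψ σ) * ψ (σ ∘ Equiv.swap x y)).re = t at *
      generalize ‖ψ σ‖ = p at *
      generalize ‖ψ (σ ∘ Equiv.swap x y)‖ = q at *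
      have hpq : p * q ≤ (p ^ 2 + q ^ 2) / 2 := by nlinarith [sq_nonneg (p - q)]
      have ht1 : d * t ≤ d * ((p ^ 2 + q ^ 2) / 2) := by gcongr; linarith
      have ht2 : -(d * ((p ^ 2 + q ^ 2) / 2)) ≤ d * t := by
        rw [← mul_neg]; gcongr; linarith
      have hp1 : (1 - d) * p ^ 2 ≤ r * p ^ 2 := by gcongr
      have hp2 : r * p ^ 2 ≤ 1 * p ^ 2 := by gcongr
      have hcase : (σ x = 0 ∧ σ y = 1) ∨ (σ x = 1 ∧ σ y = 0) := by omega
      rcases hcase with ⟨hx, hy⟩ | ⟨hx, hy⟩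
      · simp only [hx, hy, and_self, if_true]
        rw [abs_le]
        constructor <;> nlinarith
      · simp only [hx, hy, one_ne_zero, zero_ne_one, and_self, if_false]
        rw [abs_le]
        constructor <;> nlinarith
  calc _ = |∑ σ : Config L, ((star (ψ σ) * (bond Δ x y *ᵥ ψ) σ).re
        - (if σ x = 0 ∧ σ y = 1 then 1 else 0) * ‖ψ σ‖ ^ 2)| := by
        rw [Finset.sum_sub_distrib, energy, dotProduct, Complex.re_sum]
        rfl
    _ ≤ ∑ σ : Config L, (if σ x = σ y then 0 else 1) *
        (d * (3 / 4) * ‖ψ σ‖ ^ 2 + d / 4 * ‖ψ (σ ∘ Equiv.swap x y)‖ ^ 2) :=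
        (Finset.abs_sum_le_sum_abs _ _).trans (Finset.sum_le_sum fun σ _ => key σ)
    _ = d * (3 / 4) * (∑ σ : Config L, (if σ x = σ y then 0 else 1) * ‖ψ σ‖ ^ 2)
        + d / 4 * ∑ σ : Config L, (if σ x = σ y then 0 else 1) *
          ‖ψ (σ ∘ Equiv.swap x y)‖ ^ 2 := by
        rw [Finset.mul_sum, Finset.mul_sum, ← Finset.sum_add_distrib]
        refine Finset.sum_congr rfl fun σ _ => ?_
        ring
    _ = _ := by
        rw [hsum]
        ring

end Bond

/-! ### The magnetic field: phases and irreducibility. -/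

section Field

/-- The one-site operator `v · S`. -/
def fieldMatrix (v : EuclideanSpace ℝ (Fin 3)) : Matrix (Fin 2) (Fin 2) ℂ :=
  ∑ j, ((v j : ℝ) : ℂ) • spin j

lemma V_eq_sum_siteOp (B : ℤ → EuclideanSpace ℝ (Fin 3)) (m : ℤ) (L : ℕ) :
    V B m L = ∑ x : Fin L, siteOp (fieldMatrix (B (m + (x : ℕ)))) x := by
  refine Finset.sum_congr rfl fun x _ => ?_
  ext σ τ
  simp only [Matrix.sum_apply, Matrix.smul_apply, S, siteOp, of_apply, fieldMatrix, smul_eq_mul]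
  split_ifs <;> simp

lemma fieldMatrix_zero : fieldMatrix 0 = 0 := by
  simp [fieldMatrix]

lemma fieldMatrix_zero_one (v : EuclideanSpace ℝ (Fin 3)) :
    fieldMatrix v 0 1 = (v 0 - v 1 * Complex.I) / 2 := by
  simp [fieldMatrix, Fin.sum_univ_three, spin, Matrix.sum_apply]
  ring

lemma fieldMatrix_one_zero (v : EuclideanSpace ℝ (Fin 3)) :
    fieldMatrix v 1 0 = star (fieldMatrix v 0 1) := by
  rw [fieldMatrix_zero_one]
  simp [fieldMatrix, Fin.sum_univ_three, spin, Matrix.sum_apply]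
  ring

/-- The off-diagonal entry is the xy-component of the field, so assumption (A2) says that the field
flips each spin of the support with nonzero amplitude. -/
lemma fieldMatrix_zero_one_ne_zero {v : EuclideanSpace ℝ (Fin 3)}
    (hv : v ≠ !₂[0, 0, ‖v‖] ∧ v ≠ !₂[0, 0, -‖v‖]) : fieldMatrix v 0 1 ≠ 0 := by
  intro h
  rw [fieldMatrix_zero_one, div_eq_zero_iff, or_iff_left (by norm_num)] at h
  have h0 : v 0 = 0 := by simpa using congrArg Complex.re h
  have h1 : v 1 = 0 := by simpa using congrArg Complex.im h
  have hn : ‖v‖ = |v 2| := by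
    rw [EuclideanSpace.norm_eq, Fin.sum_univ_three, h0, h1]
    simp [Real.sqrt_sq_eq_abs]
  rcases abs_choice (v 2) with h2 | h2
  · apply hv.1
    ext j
    fin_cases j
    · simpa using h0
    · simpa using h1
    · simp [hn, h2]
  · apply hv.2
    ext j
    fin_cases j
    · simpa using h0
    · simpa using h1
    · simp [hn, h2]

/-- A set of configurations that is closed under single-site changes is everything. -/
lemma eq_univ_of_closed {L : ℕ} {s : Set (Config L)} (hs : s.Nonempty)
    (h : ∀ σ ∈ s, ∀ x a, Function.update σ x a ∈ s) : s = Set.univ := by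
  classical
  obtain ⟨σ, hσ⟩ := hs
  refine Set.eq_univ_of_forall fun τ => ?_
  have : ∀ F : Finset (Fin L), F.piecewise τ σ ∈ s := fun F => by
    induction F using Finset.induction_on with
    | empty => simpa using hσ
    | insert x F _ ih =>
      rw [Finset.piecewise_insert]
      exact h _ ih _ _
  simpa using this Finset.univ

variable {L : ℕ} {B : ℤ → EuclideanSpace ℝ (Fin 3)} {a : ℤ}

/-- The entry of `V` between configurations that differ exactly at `x`. -/
lemma V_apply_of_differ {σ τ : Config L} {x : Fin L} (h : ∀ y, y ≠ x → σ y = τ y)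
    (hx : σ x ≠ τ x) : V B a L σ τ = fieldMatrix (B (a + (x : ℕ))) (σ x) (τ x) := by
  rw [V_eq_sum_siteOp, Matrix.sum_apply, Finset.sum_eq_single x]
  · simp only [siteOp, of_apply, if_pos h]
  · intro y _ hy
    simp only [siteOp, of_apply]
    exact if_neg fun h' => hx (h' x hy.symm)
  · simp

lemma V_apply_of_not_differ {σ τ : Config L} (h : ¬∃ x, ∀ y, y ≠ x → σ y = τ y) :
    V B a L σ τ = 0 := by
  rw [V_eq_sum_siteOp, Matrix.sum_apply]
  refine Finset.sum_eq_zero fun x _ => ?_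
  simp only [siteOp, of_apply]
  exact if_neg fun h' => h ⟨x, h'⟩

/-- Perron–Frobenius applies whatever the real diagonal `d`: V only flips single spins, a phase at
each site makes all flip amplitudes negative, and single flips connect all configurations. -/
lemma ne_zero_of_ground_field (hB : ∀ x : Fin L, fieldMatrix (B (a + (x : ℕ))) 0 1 ≠ 0)
    (d : Config L → ℝ) (E : ℝ)
    (hE : ∀ ψ, E * mass ψ ≤ energy (diagonal (fun σ => (d σ : ℂ)) + V B a L) ψ)
    (ψ : Config L → ℂ) (h0 : ψ ≠ 0)
    (hψ : energy (diagonal (fun σ => (d σ : ℂ)) + V B a L) ψ ≤ E * mass ψ) (σ : Config L) :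
    ψ σ ≠ 0 := by
  set c : Fin L → ℂ := fun x => fieldMatrix (B (a + (x : ℕ))) 0 1 with hc
  -- The phase of spin down is chosen so that `star (w x 0) * c x * w x 1 = -‖c x‖`.
  set w : Fin L → Fin 2 → ℂ := fun x s => if s = 0 then 1 else -(star (c x) / ‖c x‖) with hw
  have hcn : ∀ x, (‖c x‖ : ℂ) ≠ 0 := fun x => by simpa using hB x
  have hw1 : ∀ x s, ‖w x s‖ = 1 := fun x s => by
    simp only [hw]
    split_ifs
    · simp
    · rw [norm_neg, norm_div, norm_star, Complex.norm_real, norm_norm, div_self]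
      simpa using hB x
  have hw2 : ∀ x s, star (w x s) * w x s = 1 := fun x s => by
    have := Complex.conj_mul' (w x s)
    simpa [hw1 x s] using this
  have hoff : ∀ σ τ : Config L, σ ≠ τ →
      (diagonal (fun σ => (d σ : ℂ)) + V B a L) σ τ = V B a L σ τ := fun σ τ h => by
    simp [h]
  refine ne_zero_of_ground (A := diagonal (fun σ => (d σ : ℂ)) + V B a L)
    (u := fun σ => ∏ x, w x (σ x)) ?_ (fun σ => ?_) (fun σ τ hστ => ?_) (fun s hs hcl => ?_)
    hE h0 hψ σ
  · refine IsHermitian.add ?_ (V_isHermitian B a L)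
    rw [isHermitian_diagonal_iff]
    intro σ
    simp [IsSelfAdjoint]
  · rw [norm_prod]
    exact Finset.prod_eq_one fun x _ => hw1 x _
  · rw [hoff σ τ hστ]
    by_cases h : ∃ x, ∀ y, y ≠ x → σ y = τ y
    · obtain ⟨x, hx⟩ := h
      have hne : σ x ≠ τ x := fun h => hστ (funext fun y => by
        by_cases hy : y = x
        · rw [hy, h]
        · exact hx y hy)
      have hprod : star (∏ y, w y (σ y)) * ∏ y, w y (τ y) = star (w x (σ x)) * w x (τ x) := by
        rw [star_prod, ← Finset.prod_mul_distrib]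
        refine Finset.prod_eq_single x (fun y _ hy => ?_) (by simp)
        rw [hx y hy, hw2]
      rw [V_apply_of_differ hx hne]
      have key : star (w x (σ x)) * w x (τ x) * fieldMatrix (B (a + (x : ℕ))) (σ x) (τ x)
          = -(‖fieldMatrix (B (a + (x : ℕ))) (σ x) (τ x)‖ : ℂ) := by
        have hcase : (σ x = 0 ∧ τ x = 1) ∨ (σ x = 1 ∧ τ x = 0) := by omega
        have hcc : star (c x) * c x = (‖c x‖ : ℂ) ^ 2 := Complex.conj_mul' (c x)
        rcases hcase with ⟨h1, h2⟩ | ⟨h1, h2⟩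
        · rw [h1, h2]
          change star (w x 0) * w x 1 * c x = -(‖c x‖ : ℂ)
          simp only [hw, if_true, one_ne_zero, if_false, star_one, one_mul]
          rw [neg_mul, div_mul_eq_mul_div, hcc, sq, mul_div_assoc, div_self (hcn x), mul_one]
        · rw [h1, h2, fieldMatrix_one_zero, norm_star]
          change star (w x 1) * w x 0 * star (c x) = -(‖c x‖ : ℂ)
          simp only [hw, if_true, one_ne_zero, if_false, mul_one, star_neg, star_div₀, star_star]
          rw [show star (‖c x‖ : ℂ) = (‖c x‖ : ℂ) from Complex.conj_ofReal _, neg_mul,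
            div_mul_eq_mul_div, mul_comm (c x), hcc, sq, mul_div_assoc, div_self (hcn x), mul_one]
      rw [← key, ← hprod]
      ring
    · rw [V_apply_of_not_differ h]
      simp
  · refine eq_univ_of_closed hs fun σ hσ x b => ?_
    by_cases hb : b = σ x
    · rw [hb, Function.update_eq_self]
      exact hσ
    · have hne : σ x ≠ Function.update σ x b x := by simpa using Ne.symm hb
      refine hcl σ hσ _ ?_
      rw [hoff _ _ (fun h => hne (congrFun h x)),
        V_apply_of_differ (fun y hy => by simp [hy]) hne]
      rw [Function.update_self]
      have hcase : (σ x = 0 ∧ b = 1) ∨ (σ x = 1 ∧ b = 0) := by omega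
      rcases hcase with ⟨h1, h2⟩ | ⟨h1, h2⟩
      · rw [h1, h2]
        exact hB x
      · rw [h1, h2, fieldMatrix_one_zero]
        exact star_ne_zero.mpr (hB x)

end Field

/-! ### Counting kinks and walls. -/

section Kinks

/-- The number of up-down bonds of a sequence between `a` and `b`. -/
def seqKinks (s : ℕ → Fin 2) (a b : ℕ) : ℕ :=
  ∑ x ∈ Finset.Ico a b, if s x = 0 ∧ s (x + 1) = 1 then 1 else 0

/-- A discrete intermediate value argument: between an up spin and a later down spin some bond goes
from up to down. -/
lemma seqKinks_pos {s : ℕ → Fin 2} {a x b : ℕ} (hax : a ≤ x) (hxb : x ≤ b) (hx : s x = 0)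
    (hb : s b = 1) : 1 ≤ seqKinks s a b := by
  induction b, hxb using Nat.le_induction with
  | base => simp [hx] at hb
  | succ b hxb ih =>
    rw [seqKinks, Finset.sum_Ico_succ_top (hax.trans hxb)]
    rcases fin_two_cases (s b) with h | h
    · simp [h, hb]
    · exact (ih h).trans (Nat.le_add_right _ _)

lemma seqKinks_eq_zero {s : ℕ → Fin 2} {a b : ℕ}
    (h : ∀ x, a ≤ x → x < b → s x = 0 → s (x + 1) = 0) : seqKinks s a b = 0 := by
  refine Finset.sum_eq_zero fun x hx => ?_
  rw [Finset.mem_Ico] at hx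
  rw [if_neg]
  rintro ⟨h0, h1⟩
  rw [h x hx.1 hx.2 h0] at h1
  exact absurd h1 (by decide)

lemma seqKinks_consecutive (s : ℕ → Fin 2) {a b c : ℕ} (hab : a ≤ b) (hbc : b ≤ c) :
    seqKinks s a c = seqKinks s a b + seqKinks s b c :=
  (Finset.sum_Ico_consecutive _ hab hbc).symm

/-- Walls of the two kinds alternate. The exact balance, proved by induction, corrects twice the
number of kinks by the two end spins. -/
lemma sum_walls_le (s : ℕ → Fin 2) (n : ℕ) :
    ∑ x ∈ Finset.range n, (if s x = s (x + 1) then 0 else 1) ≤ 2 * seqKinks s 0 n + 1 := by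
  have key : ∑ x ∈ Finset.range n, (if s x = s (x + 1) then 0 else 1) + (if s 0 = 0 then 1 else 0)
      = 2 * seqKinks s 0 n + if s n = 0 then 1 else 0 := by
    induction n with
    | zero => simp [seqKinks]
    | succ n ih =>
      rw [Finset.sum_range_succ, seqKinks, Finset.sum_Ico_succ_top (Nat.zero_le n), ← seqKinks]
      rcases fin_two_cases (s n) with h | h <;> rcases fin_two_cases (s (n + 1)) with h' | h' <;>
        simp only [h, h'] at ih ⊢ <;> norm_num at ih ⊢ <;> omega
  have : (if s n = 0 then 1 else 0) ≤ 1 := by split_ifs <;> norm_num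
  omega

/-- The number of up-down bonds of a configuration. -/
def kinks {n : ℕ} (σ : Config (n + 1)) : ℕ :=
  ∑ x : Fin n, if σ x.castSucc = 0 ∧ σ x.succ = 1 then 1 else 0

/-- A configuration as a sequence. -/
def toSeq {n : ℕ} (σ : Config (n + 1)) (x : ℕ) : Fin 2 :=
  if h : x < n + 1 then σ ⟨x, h⟩ else 0

lemma toSeq_coe {n : ℕ} (σ : Config (n + 1)) (x : Fin (n + 1)) : toSeq σ x = σ x :=
  dif_pos x.2

lemma sum_bonds_eq {M : Type*} [AddCommMonoid M] {n : ℕ} (σ : Config (n + 1))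
    (f : Fin 2 → Fin 2 → M) :
    ∑ x : Fin n, f (σ x.castSucc) (σ x.succ)
      = ∑ x ∈ Finset.range n, f (toSeq σ x) (toSeq σ (x + 1)) := by
  rw [← Fin.sum_univ_eq_sum_range (fun x => f (toSeq σ x) (toSeq σ (x + 1)))]
  refine Finset.sum_congr rfl fun x _ => ?_
  rw [← toSeq_coe σ x.castSucc, ← toSeq_coe σ x.succ, Fin.val_castSucc, Fin.val_succ]

lemma kinks_eq_seqKinks {n : ℕ} (σ : Config (n + 1)) : kinks σ = seqKinks (toSeq σ) 0 n := by
  rw [seqKinks, ← Finset.range_eq_Ico]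
  exact sum_bonds_eq σ fun a b => if a = 0 ∧ b = 1 then 1 else 0

lemma walls_le {n : ℕ} (σ : Config (n + 1)) :
    ∑ x : Fin n, (if σ x.castSucc = σ x.succ then 0 else 1) ≤ 2 * kinks σ + 1 := by
  rw [kinks_eq_seqKinks, sum_bonds_eq σ fun a b => if a = b then 0 else 1]
  exact sum_walls_le _ _

/-- Uniformly in the length of the chain, `H₀` is a relatively small perturbation of the number
of kinks. -/
lemma abs_energy_H0_sub_le {Δ : ℝ} (hΔ : 1 ≤ Δ) {n : ℕ} (ψ : Config (n + 1) → ℂ) :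
    |energy (H0 (n + 1) Δ) ψ - ∑ σ, (kinks σ : ℝ) * ‖ψ σ‖ ^ 2|
      ≤ Δ⁻¹ * (2 * (∑ σ, (kinks σ : ℝ) * ‖ψ σ‖ ^ 2) + mass ψ) := by
  have h1 : ∑ σ, (kinks σ : ℝ) * ‖ψ σ‖ ^ 2 = ∑ x : Fin n, ∑ σ : Config (n + 1),
      (if σ x.castSucc = 0 ∧ σ x.succ = 1 then 1 else 0) * ‖ψ σ‖ ^ 2 := by
    rw [Finset.sum_comm]
    refine Finset.sum_congr rfl fun σ _ => ?_
    rw [kinks, ← Finset.sum_mul]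
    push_cast
    rfl
  -- Summed over the bonds, the errors count the walls, which the kinks control independently of
  -- `n`.
  have h2 : ∑ x : Fin n, ∑ σ : Config (n + 1),
      (if σ x.castSucc = σ x.succ then 0 else 1) * ‖ψ σ‖ ^ 2
      ≤ 2 * (∑ σ, (kinks σ : ℝ) * ‖ψ σ‖ ^ 2) + mass ψ := by
    rw [Finset.sum_comm, mass, Finset.mul_sum, ← Finset.sum_add_distrib]
    refine Finset.sum_le_sum fun σ _ => ?_
    have h3 : (∑ x : Fin n, (if σ x.castSucc = σ x.succ then 0 else 1) : ℝ)
        ≤ 2 * (kinks σ : ℝ) + 1 := by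
      have := walls_le σ
      exact_mod_cast this
    calc _ = (∑ x : Fin n, (if σ x.castSucc = σ x.succ then 0 else 1) : ℝ) * ‖ψ σ‖ ^ 2 := by
          rw [Finset.sum_mul]
      _ ≤ (2 * (kinks σ : ℝ) + 1) * ‖ψ σ‖ ^ 2 := by gcongr
      _ = _ := by ring
  rw [H0_succ, energy_sum, h1, ← Finset.sum_sub_distrib]
  refine (Finset.abs_sum_le_sum_abs _ _).trans ?_
  refine (Finset.sum_le_sum fun x _ =>
    abs_energy_bond_sub_le hΔ (Fin.castSucc_lt_succ (i := x)).ne ψ).trans ?_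
  rw [← Finset.mul_sum, ← h1]
  exact mul_le_mul_of_nonneg_left h2 (by positivity)

end Kinks

/-! ### Decomposition by the spins outside the support. -/

section Slices

variable {l L : ℕ} {j : Fin l → Fin L} (hj : Function.Injective j)

/-- The sites outside of the range of `j`. -/
abbrev Outer (j : Fin l → Fin L) : Type := ((Set.range j)ᶜ : Set (Fin L))

open Classical in
/-- The sites of the chain, split into the range of `j` and the other sites. -/
def siteEquiv (hj : Function.Injective j) : Fin l ⊕ Outer j ≃ Fin L :=
  ((Equiv.ofInjective j hj).sumCongr (Equiv.refl _)).trans (Equiv.Set.sumCompl (Set.range j))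

/-- A configuration of the chain is a configuration of the sites in the range of `j` together with
a configuration of the other sites. -/
def glue (hj : Function.Injective j) : Config l × (Outer j → Fin 2) ≃ Config L :=
  (Equiv.sumArrowEquivProdArrow _ _ _).symm.trans ((siteEquiv hj).arrowCongr (Equiv.refl _))

lemma glue_apply (τ : Config l) (η : Outer j → Fin 2) (x : Fin l ⊕ Outer j) :
    glue hj (τ, η) (siteEquiv hj x) = Sum.elim τ η x :=
  congrArg (Sum.elim τ η) ((siteEquiv hj).symm_apply_apply x)

lemma glue_apply_inner (τ : Config l) (η : Outer j → Fin 2) (i : Fin l) :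
    glue hj (τ, η) (j i) = τ i :=
  glue_apply hj τ η (Sum.inl i)

lemma glue_apply_outer (τ : Config l) (η : Outer j → Fin 2) (x : Outer j) :
    glue hj (τ, η) x = η x :=
  glue_apply hj τ η (Sum.inr x)

/-- The part of a state with outer configuration `η`. -/
def slice (hj : Function.Injective j) (ψ : Config L → ℂ) (η : Outer j → Fin 2) (τ : Config l) : ℂ :=
  ψ (glue hj (τ, η))

variable [Fintype (Outer j)]

lemma sum_eq_sum_glue {M : Type*} [AddCommMonoid M] (f : Config L → M) :
    ∑ σ, f σ = ∑ η : Outer j → Fin 2, ∑ τ, f (glue hj (τ, η)) := by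
  rw [← (glue hj).sum_comp, Fintype.sum_prod_type_right]

lemma mass_eq_sum_slice (ψ : Config L → ℂ) : mass ψ = ∑ η, mass (slice hj ψ η) :=
  sum_eq_sum_glue hj _

variable {B : ℤ → EuclideanSpace ℝ (Fin 3)} {m a : ℤ}

-- V leaves the outer spins alone, so it is block diagonal in the outer configuration, and every
-- block is the same operator on the interval.
open Classical in
lemma V_glue (hB : ∀ x ∉ Set.range j, B (m + (x : ℕ)) = 0)
    (hja : ∀ i, m + ((j i : ℕ) : ℤ) = a + (i : ℕ)) (τ τ' : Config l) (η η' : Outer j → Fin 2) :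
    V B m L (glue hj (τ, η)) (glue hj (τ', η')) = if η = η' then V B a l τ τ' else 0 := by
  rw [V_eq_sum_siteOp, V_eq_sum_siteOp, Matrix.sum_apply, Matrix.sum_apply]
  have hstep : ∀ i : Fin l, siteOp (fieldMatrix (B (m + ((j i : ℕ) : ℤ)))) (j i)
      (glue hj (τ, η)) (glue hj (τ', η'))
      = if η = η' then siteOp (fieldMatrix (B (a + (i : ℕ)))) i τ τ' else 0 := by
    intro i
    have hiff : (∀ y, y ≠ j i → glue hj (τ, η) y = glue hj (τ', η') y) ↔
        η = η' ∧ ∀ y, y ≠ i → τ y = τ' y := by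
      constructor
      · intro h
        refine ⟨funext fun x => ?_, fun y hy => ?_⟩
        · have := h x fun hx => x.2 ⟨i, hx.symm⟩
          rwa [glue_apply_outer, glue_apply_outer] at this
        · have := h (j y) fun hx => hy (hj hx)
          rwa [glue_apply_inner, glue_apply_inner] at this
      · rintro ⟨rfl, h⟩ y hy
        by_cases hr : y ∈ Set.range j
        · obtain ⟨i', rfl⟩ := hr
          rw [glue_apply_inner, glue_apply_inner]
          exact h i' fun hi => hy (by rw [hi])
        · rw [glue_apply_outer hj τ η ⟨y, hr⟩, glue_apply_outer hj τ' η ⟨y, hr⟩]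
    simp only [siteOp, of_apply, hiff, glue_apply_inner, hja]
    by_cases hη : η = η'
    · simp [hη]
    · simp [hη]
  have hsum := Fintype.sum_of_injective j hj
    (fun i => if η = η' then siteOp (fieldMatrix (B (a + (i : ℕ)))) i τ τ' else 0)
    (fun x => siteOp (fieldMatrix (B (m + (x : ℕ)))) x (glue hj (τ, η)) (glue hj (τ', η')))
    (fun x hx => by simp [hB x hx, fieldMatrix_zero, siteOp]) fun i => (hstep i).symm
  rw [← hsum]
  split_ifs <;> simp

lemma energy_V_eq_sum_slice (hB : ∀ x ∉ Set.range j, B (m + (x : ℕ)) = 0)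
    (hja : ∀ i, m + ((j i : ℕ) : ℤ) = a + (i : ℕ)) (ψ : Config L → ℂ) :
    energy (V B m L) ψ = ∑ η, energy (V B a l) (slice hj ψ η) := by
  classical
  rw [energy_eq_sum, sum_eq_sum_glue hj]
  refine Finset.sum_congr rfl fun η _ => ?_
  rw [energy_eq_sum]
  refine Finset.sum_congr rfl fun τ _ => ?_
  rw [sum_eq_sum_glue hj, Finset.sum_eq_single η]
  · refine Finset.sum_congr rfl fun τ' _ => ?_
    rw [V_glue hj hB hja, if_pos rfl]
    rfl
  · intro η' _ hη
    refine Finset.sum_eq_zero fun τ' _ => ?_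
    rw [V_glue hj hB hja, if_neg hη.symm]
    simp
  · simp

end Slices

/-! ### Kinks forced by the outer spins. -/

section Interval

variable {l n k : ℕ}

/-- The embedding of an interval of `l + 1` sites at position `k` of the chain. -/
def shift (h : k + l ≤ n) (i : Fin (l + 1)) : Fin (n + 1) := ⟨k + i, by omega⟩

lemma shift_injective (h : k + l ≤ n) : Function.Injective (shift h) := fun i i' hi => by
  have := congrArg Fin.val hi
  simp only [shift] at this
  exact Fin.ext (by omega)

lemma mem_range_shift (h : k + l ≤ n) (x : Fin (n + 1)) :
    x ∈ Set.range (shift h) ↔ k ≤ x ∧ (x : ℕ) ≤ k + l := by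
  constructor
  · rintro ⟨i, rfl⟩
    have := i.2
    simp only [shift]
    omega
  · rintro ⟨h1, h2⟩
    exact ⟨⟨x - k, by omega⟩, Fin.ext (by simp only [shift]; omega)⟩

/-- The outer configuration without kinks: down to the left of the interval and up to the right. -/
def kinkOuter (h : k + l ≤ n) (x : Outer (shift h)) : Fin 2 :=
  if (x : Fin (n + 1)).val < k then 1 else 0

lemma toSeq_glue_inner (h : k + l ≤ n) (τ : Config (l + 1)) (η : Outer (shift h) → Fin 2) {i : ℕ}
    (hi : i ≤ l) : toSeq (glue (shift_injective h) (τ, η)) (k + i) = toSeq τ i := by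
  have h1 := toSeq_coe (glue (shift_injective h) (τ, η)) (shift h ⟨i, by omega⟩)
  rw [glue_apply_inner, ← toSeq_coe τ ⟨i, _⟩] at h1
  exact h1

/-- The three segments share the end sites of the interval, so the outer two see τ only through its
end spins. -/
lemma kinks_glue (h : k + l ≤ n) (τ : Config (l + 1)) (η : Outer (shift h) → Fin 2) :
    kinks (glue (shift_injective h) (τ, η))
      = seqKinks (toSeq (glue (shift_injective h) (τ, η))) 0 k + kinks τ
        + seqKinks (toSeq (glue (shift_injective h) (τ, η))) (k + l) n := by
  rw [kinks_eq_seqKinks, seqKinks_consecutive _ (Nat.zero_le (k + l)) h,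
    seqKinks_consecutive _ (Nat.zero_le k) (Nat.le_add_right k l)]
  congr 2
  rw [seqKinks, Finset.sum_Ico_eq_sum_range, Nat.add_sub_cancel_left, kinks_eq_seqKinks, seqKinks,
    ← Finset.range_eq_Ico]
  refine Finset.sum_congr rfl fun i hi => ?_
  have hi' := Finset.mem_range.mp hi
  rw [toSeq_glue_inner h τ η hi'.le, add_assoc, toSeq_glue_inner h τ η hi']

lemma toSeq_glue_outer (h : k + l ≤ n) (τ : Config (l + 1)) (η : Outer (shift h) → Fin 2)
    (x : Outer (shift h)) :
    toSeq (glue (shift_injective h) (τ, η)) (x : Fin (n + 1)) = η x := by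
  rw [toSeq_coe, glue_apply_outer]

/-- Every bond on the left starts with a down spin and every bond on the right ends with an up spin,
so none is a kink whatever τ is. -/
lemma kinks_glue_kinkOuter (h : k + l ≤ n) (τ : Config (l + 1)) :
    kinks (glue (shift_injective h) (τ, kinkOuter h)) = kinks τ := by
  have hout : ∀ x, x ≤ n → (x < k ∨ k + l < x) →
      toSeq (glue (shift_injective h) (τ, kinkOuter h)) x = if x < k then 1 else 0 := by
    intro x hx hx'
    exact toSeq_glue_outer h τ (kinkOuter h)
      ⟨⟨x, by omega⟩, by rw [Set.mem_compl_iff, mem_range_shift]; simp only; omega⟩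
  rw [kinks_glue, seqKinks_eq_zero, seqKinks_eq_zero, zero_add, add_zero]
  · intro x hx hxn _
    rw [hout _ hxn (by omega), if_neg (by omega)]
  · intro x _ hxk h0
    rw [hout x (by omega) (by omega), if_pos hxk] at h0
    exact absurd h0 (by decide)

/-- Any other outer configuration costs at least a boundary penalty at one end of the interval. -/
lemma kinks_glue_ge (h : k + l ≤ n) {η : Outer (shift h) → Fin 2} (hη : η ≠ kinkOuter h) :
    (∀ τ, kinks τ + (if τ 0 = 1 then 1 else 0) ≤ kinks (glue (shift_injective h) (τ, η))) ∨
      ∀ τ, kinks τ + (if τ (Fin.last l) = 0 then 1 else 0)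
        ≤ kinks (glue (shift_injective h) (τ, η)) := by
  obtain ⟨x, hx⟩ := Function.ne_iff.mp hη
  have hxr := x.2
  rw [Set.mem_compl_iff, mem_range_shift] at hxr
  have hxn := x.1.2
  -- A misplaced spin is an up spin on the left or a down spin on the right. The side depends on η
  -- alone, so one penalty serves all τ.
  by_cases hxk : (x : Fin (n + 1)).val < k
  · left
    intro τ
    rw [kinks_glue]
    by_cases h0 : τ 0 = 1
    · have hx0 : η x = 0 := by
        simp only [kinkOuter, if_pos hxk] at hx
        omega
      have := seqKinks_pos (s := toSeq (glue (shift_injective h) (τ, η))) (Nat.zero_le _) hxk.le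
        (by rw [toSeq_glue_outer, hx0])
        (by
          have := toSeq_glue_inner h τ η (Nat.zero_le l)
          rw [add_zero] at this
          rw [this]
          exact (toSeq_coe τ 0).trans h0)
      rw [if_pos h0]
      omega
    · rw [if_neg h0]
      omega
  · right
    intro τ
    rw [kinks_glue]
    by_cases h0 : τ (Fin.last l) = 0
    · have hx1 : η x = 1 := by
        simp only [kinkOuter, if_neg hxk] at hx
        omega
      have h1 := seqKinks_pos (s := toSeq (glue (shift_injective h) (τ, η))) (le_refl (k + l))
        (b := (x : Fin (n + 1)).val) (by omega)
        (by
          rw [toSeq_glue_inner h τ η le_rfl]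
          exact (toSeq_coe τ (Fin.last l)).trans h0)
        (by rw [toSeq_glue_outer, hx1])
      have h2 := seqKinks_consecutive (toSeq (glue (shift_injective h) (τ, η)))
        (a := k + l) (b := (x : Fin (n + 1)).val) (c := n) (by omega) (by omega)
      rw [if_pos h0]
      omega
    · rw [if_neg h0]
      omega

end Interval

/-! ### The gap at infinite anisotropy and at large Δ. -/

/-- The Hamiltonian at infinite anisotropy, restricted to the support of the field, has a unique
ground state, a gap above it, and its energy is raised by boundary penalties at either end. -/
lemma exists_local_ground {B : ℤ → EuclideanSpace ℝ (Fin 3)} {a : ℤ} {l : ℕ}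
    (hB : ∀ x : Fin (l + 1), fieldMatrix (B (a + (x : ℕ))) 0 1 ≠ 0) :
    ∃ (E₀ E₁ : ℝ) (φ : Config (l + 1) → ℂ), E₀ < E₁ ∧ mass φ = 1 ∧
      ∑ τ, (kinks τ : ℝ) * ‖φ τ‖ ^ 2 + energy (V B a (l + 1)) φ = E₀ ∧
      (∀ ψ, star φ ⬝ᵥ ψ = 0 →
        E₁ * mass ψ ≤ ∑ τ, (kinks τ : ℝ) * ‖ψ τ‖ ^ 2 + energy (V B a (l + 1)) ψ) ∧
      (∀ ψ, E₁ * mass ψ ≤ ∑ τ, ((kinks τ + if τ 0 = 1 then 1 else 0 : ℕ) : ℝ) * ‖ψ τ‖ ^ 2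
        + energy (V B a (l + 1)) ψ) ∧
      ∀ ψ, E₁ * mass ψ ≤
        ∑ τ, ((kinks τ + if τ (Fin.last l) = 0 then 1 else 0 : ℕ) : ℝ) * ‖ψ τ‖ ^ 2
          + energy (V B a (l + 1)) ψ := by
  have hA : (diagonal (fun σ : Config (l + 1) => ((kinks σ : ℝ) : ℂ))
      + V B a (l + 1)).IsHermitian := by
    refine IsHermitian.add ?_ (V_isHermitian B a _)
    rw [isHermitian_diagonal_iff]
    intro σ
    simp [IsSelfAdjoint]
  obtain ⟨E₀, E₁, φ, hlt, hm, he, hgap, hpen⟩ := exists_ground_gap hA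
    (ne_zero_of_ground_field hB fun σ => (kinks σ : ℝ))
    (fun (b : Bool) (τ : Config (l + 1)) =>
      if b then (if τ 0 = 1 then 1 else 0) else if τ (Fin.last l) = 0 then 1 else 0)
    (fun b τ => by split_ifs <;> norm_num)
    -- The penalties are positive somewhere: on all spins down at the left end, on all spins up at
    -- the right end.
    (fun b => ⟨fun _ => if b then 1 else 0, by cases b <;> simp⟩)
  simp only [energy_add, energy_diagonal] at he hgap hpen
  refine ⟨E₀, E₁, φ, hlt, hm, he, hgap, fun ψ => ?_, fun ψ => ?_⟩
  · refine (hpen true ψ).trans_eq ?_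
    simp only [Nat.cast_add, add_mul, Finset.sum_add_distrib, Nat.cast_ite, Nat.cast_one,
      Nat.cast_zero, if_true]
    ring
  · refine (hpen false ψ).trans_eq ?_
    simp only [Nat.cast_add, add_mul, Finset.sum_add_distrib, Nat.cast_ite, Nat.cast_one,
      Nat.cast_zero, Bool.false_eq_true, if_false]
    ring

/-- At infinite anisotropy the ground state of the chain is that of the support of the field,
with all spins down to the left and up to the right, and the gap is that of the support. -/
lemma exists_chain_ground {B : ℤ → EuclideanSpace ℝ (Fin 3)} {a m : ℤ} {l n k : ℕ} {E₀ E₁ : ℝ}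
    {φ : Config (l + 1) → ℂ} (hm : mass φ = 1)
    (he : ∑ τ, (kinks τ : ℝ) * ‖φ τ‖ ^ 2 + energy (V B a (l + 1)) φ = E₀)
    (hgap : ∀ ψ, star φ ⬝ᵥ ψ = 0 →
      E₁ * mass ψ ≤ ∑ τ, (kinks τ : ℝ) * ‖ψ τ‖ ^ 2 + energy (V B a (l + 1)) ψ)
    (hleft : ∀ ψ, E₁ * mass ψ ≤
      ∑ τ, ((kinks τ + if τ 0 = 1 then 1 else 0 : ℕ) : ℝ) * ‖ψ τ‖ ^ 2
        + energy (V B a (l + 1)) ψ)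
    (hright : ∀ ψ, E₁ * mass ψ ≤
      ∑ τ, ((kinks τ + if τ (Fin.last l) = 0 then 1 else 0 : ℕ) : ℝ) * ‖ψ τ‖ ^ 2
        + energy (V B a (l + 1)) ψ)
    (h : k + l ≤ n) (hB : ∀ x ∉ Set.range (shift h), B (m + (x : ℕ)) = 0) (hma : m + k = a) :
    ∃ Φ : Config (n + 1) → ℂ, mass Φ = 1 ∧
      ∑ σ, (kinks σ : ℝ) * ‖Φ σ‖ ^ 2 + energy (V B m (n + 1)) Φ = E₀ ∧
      ∀ ψ, star Φ ⬝ᵥ ψ = 0 →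
        E₁ * mass ψ ≤ ∑ σ, (kinks σ : ℝ) * ‖ψ σ‖ ^ 2 + energy (V B m (n + 1)) ψ := by
  classical
  have hj := shift_injective h
  have hja : ∀ i : Fin (l + 1), m + ((shift h i : ℕ) : ℤ) = a + (i : ℕ) := fun i => by
    simp only [shift]
    push_cast
    omega
  have hform : ∀ ψ : Config (n + 1) → ℂ,
      ∑ σ, (kinks σ : ℝ) * ‖ψ σ‖ ^ 2 + energy (V B m (n + 1)) ψ
      = ∑ η, (∑ τ, (kinks (glue hj (τ, η)) : ℝ) * ‖slice hj ψ η τ‖ ^ 2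
        + energy (V B a (l + 1)) (slice hj ψ η)) := fun ψ => by
    rw [energy_V_eq_sum_slice hj hB hja, sum_eq_sum_glue hj, Finset.sum_add_distrib]
    rfl
  -- The product of φ with the kink-free outer configuration.
  set Φ : Config (n + 1) → ℂ := fun σ =>
    if ((glue hj).symm σ).2 = kinkOuter h then φ ((glue hj).symm σ).1 else 0 with hΦ
  have hslice : ∀ η, slice hj Φ η = if η = kinkOuter h then φ else 0 := fun η => by
    ext τ
    simp only [slice, hΦ, Equiv.symm_apply_apply]
    split_ifs <;> rfl
  have hzero : mass (0 : Config (l + 1) → ℂ) = 0 := by simp [mass]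
  refine ⟨Φ, ?_, ?_, fun ψ hψ => ?_⟩
  · rw [mass_eq_sum_slice hj, Finset.sum_eq_single (kinkOuter h)]
    · rw [hslice, if_pos rfl, hm]
    · intro η _ hη
      rw [hslice, if_neg hη, hzero]
    · simp
  · rw [hform, Finset.sum_eq_single (kinkOuter h)]
    · simp only [hslice, if_pos, kinks_glue_kinkOuter, he]
    · intro η _ hη
      simp [hslice, if_neg hη, energy]
    · simp
  · have horth : star φ ⬝ᵥ slice hj ψ (kinkOuter h) = 0 := by
      rw [← hψ, dotProduct, dotProduct, sum_eq_sum_glue hj,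
        Finset.sum_eq_single (kinkOuter h)]
      · refine Finset.sum_congr rfl fun τ _ => ?_
        have := congrFun (hslice (kinkOuter h)) τ
        rw [if_pos rfl] at this
        rw [Pi.star_apply, Pi.star_apply, ← this]
        rfl
      · intro η _ hη
        refine Finset.sum_eq_zero fun τ _ => ?_
        have := congrFun (hslice η) τ
        rw [if_neg hη] at this
        rw [Pi.star_apply, show Φ (glue hj (τ, η)) = 0 from this, star_zero, zero_mul]
      · simp
    rw [hform, mass_eq_sum_slice hj, Finset.mul_sum]
    refine Finset.sum_le_sum fun η _ => ?_
    by_cases hη : η = kinkOuter h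
    · subst hη
      simp only [kinks_glue_kinkOuter]
      exact hgap _ horth
    · rcases kinks_glue_ge h hη with hk | hk
      · refine (hleft (slice hj ψ η)).trans ?_
        gcongr with τ _
        exact hk τ
      · refine (hright (slice hj ψ η)).trans ?_
        gcongr with τ _
        exact hk τ

/-- A nonempty finite order-connected set of integers is an interval. -/
lemma exists_eq_Icc {s : Set ℤ} (hfin : s.Finite) (hne : s.Nonempty) (hs : s.OrdConnected) :
    ∃ (a : ℤ) (l : ℕ), s = Set.Icc a (a + l) := by
  obtain ⟨a, ha, hamin⟩ := Set.exists_min_image s id hfin hne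
  obtain ⟨b, hb, hbmax⟩ := Set.exists_max_image s id hfin hne
  have hab : a ≤ b := hamin b hb
  refine ⟨a, (b - a).toNat, ?_⟩
  rw [show a + ((b - a).toNat : ℤ) = b by omega]
  exact Set.Subset.antisymm (fun x hx => ⟨hamin x hx, hbmax x hx⟩) (hs.out ha hb)

lemma re_inner_act {L : ℕ} (H : Op L) (ψ : Space L) :
    (⟪ψ, act H ψ⟫_ℂ).re = energy H ψ.ofLp := by
  rw [EuclideanSpace.inner_eq_star_dotProduct, dotProduct_comm]
  rfl

lemma norm_sq_eq_mass {L : ℕ} (ψ : Space L) : ‖ψ‖ ^ 2 = mass ψ.ofLp :=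
  EuclideanSpace.norm_sq_eq ψ

/-- The uniform gap above the ground state for large anisotropy. -/
theorem exists_uniform_gap (B : ℤ → EuclideanSpace ℝ (Fin 3))
    (hfin : (Function.support B).Finite) (hne : (Function.support B).Nonempty)
    (hint : (Function.support B).OrdConnected)
    (hxy : ∀ x ∈ Function.support B, B x ≠ !₂[0, 0, ‖B x‖] ∧ B x ≠ !₂[0, 0, -‖B x‖]) :
    ∃ Δ₀ : ℝ, 1 ≤ Δ₀ ∧ ∀ Δ : ℝ, Δ₀ < Δ → ∃ γ : ℝ, 0 < γ ∧
      ∀ (m : ℤ) (L : ℕ), Function.support B ⊆ chain m L →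
        ∃ (E₀ : ℝ) (Ω : Space L),
          IsUniqueGroundState (HV Δ B m L) E₀ Ω ∧
          ∀ ψ : Space L, ⟪Ω, ψ⟫_ℂ = 0 →
            γ * ‖ψ‖ ^ 2 ≤
              (⟪ψ, act (HV Δ B m L) ψ - (E₀ : ℂ) • ψ⟫_ℂ).re := by
  classical
  obtain ⟨a, l, hsupp⟩ := exists_eq_Icc hfin hne hint
  have hB : ∀ x : Fin (l + 1), fieldMatrix (B (a + (x : ℕ))) 0 1 ≠ 0 := fun x =>
    fieldMatrix_zero_one_ne_zero (hxy _ (by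
      rw [hsupp, Set.mem_Icc]
      have := x.2
      omega))
  obtain ⟨E₀, E₁, φ, hlt, hm, he, hgap, hleft, hright⟩ := exists_local_ground hB
  obtain ⟨v, hv0, hv⟩ := exists_abs_energy_le (V B a (l + 1))
  -- Below, `lo - up = E₁ - E₀ - d * (2 * E₀ + 2 * E₁ + 4 * v + 2)`, so `d * C < E₁ - E₀` makes it
  -- positive. The bound Δ > 2 serves to keep 1 - 2d nonnegative.
  set C := 2 * |E₀| + 2 * |E₁| + 4 * v + 2 with hC
  have hCpos : 0 < C := by positivity
  refine ⟨max 2 (C / (E₁ - E₀)), le_max_of_le_left one_le_two, fun Δ hΔ => ?_⟩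
  have hΔ2 : 2 < Δ := (le_max_left _ _).trans_lt hΔ
  have hΔC : C / (E₁ - E₀) < Δ := (le_max_right _ _).trans_lt hΔ
  set d := Δ⁻¹ with hd
  have hd0 : 0 < d := by positivity
  have hd2 : d ≤ 1 / 2 := by
    rw [hd, one_div]
    exact inv_anti₀ two_pos hΔ2.le
  have hdC : d * C < E₁ - E₀ := by
    rw [div_lt_iff₀ (sub_pos.mpr hlt)] at hΔC
    rw [hd, inv_mul_lt_iff₀ (by positivity)]
    exact hΔC
  -- With kink form K and field form W, the energy lies between (1 ∓ 2d)K + W ∓ d for unit vectors.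
  -- Writing this as (1 ∓ 2d)(K + W) ± 2dW ∓ d and using |W| ≤ v gives both bounds.
  set up := (1 + 2 * d) * E₀ + d * (2 * v + 1) with hup
  set lo := (1 - 2 * d) * E₁ - d * (2 * v + 1) with hlo
  have hul : up < lo := by
    have h1 : d * E₀ ≤ d * |E₀| := by gcongr; exact le_abs_self _
    have h2 : d * E₁ ≤ d * |E₁| := by gcongr; exact le_abs_self _
    rw [hC] at hdC
    nlinarith
  refine ⟨lo - up, sub_pos.mpr hul, fun m L hchain => ?_⟩
  have hma : m ≤ a := (hchain (hsupp ▸ (⟨le_rfl, by omega⟩ : a ∈ Set.Icc a (a + l)))).1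
  have hmb : a + l < m + L :=
    (hchain (hsupp ▸ (⟨by omega, le_rfl⟩ : a + (l : ℤ) ∈ Set.Icc a (a + l)))).2
  obtain ⟨n, rfl⟩ : ∃ n, L = n + 1 := ⟨L - 1, by omega⟩
  obtain ⟨k, hk⟩ : ∃ k : ℕ, m + k = a := ⟨(a - m).toNat, by omega⟩
  have h : k + l ≤ n := by omega
  have hBout : ∀ x ∉ Set.range (shift h), B (m + (x : ℕ)) = 0 := fun x hx => by
    by_contra hx'
    have hmem : m + ((x : ℕ) : ℤ) ∈ Function.support B := hx'
    rw [hsupp, Set.mem_Icc] at hmem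
    exact hx ((mem_range_shift h x).mpr (by omega))
  obtain ⟨Φ, hΦm, hΦe, hΦgap⟩ := exists_chain_ground hm he hgap hleft hright h hBout hk
  -- The bound v of the interval holds on the whole chain, since V acts as the same block on every
  -- slice.
  have hvn : ∀ ψ, |energy (V B m (n + 1)) ψ| ≤ v * mass ψ := fun ψ => by
    rw [energy_V_eq_sum_slice (shift_injective h) hBout
        (a := a) (fun i => by simp only [shift]; push_cast; omega),
      mass_eq_sum_slice (shift_injective h), Finset.mul_sum]
    exact (Finset.abs_sum_le_sum_abs _ _).trans (Finset.sum_le_sum fun η _ => hv _)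
  have hpert := fun ψ => abs_le.mp (abs_energy_H0_sub_le (n := n) (by linarith : 1 ≤ Δ) ψ)
  have hherm : (HV Δ B m (n + 1)).IsHermitian :=
    (H0_succ_isHermitian n Δ).add (V_isHermitian B m _)
  obtain ⟨E, Ω, hleast, hnorm, heig, hfin⟩ := exists_ground_of_trial
    (T := act (HV Δ B m (n + 1))) (Matrix.isSymmetric_toEuclideanLin_iff.mpr hherm)
    (φ := WithLp.toLp 2 Φ) hul
    (by
      rw [← sq_eq_sq₀ (norm_nonneg _) zero_le_one, norm_sq_eq_mass, one_pow]
      exact hΦm)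
    (by
      rw [re_inner_act, HV, energy_add]
      have h1 := (hpert Φ).2
      have h2 := abs_le.mp (hvn Φ)
      rw [hΦm] at h1 h2
      rw [hup]
      change energy (H0 (n + 1) Δ) Φ + energy (V B m (n + 1)) Φ ≤ _
      nlinarith)
    (fun ψ hψ => by
      rw [re_inner_act, norm_sq_eq_mass, HV, energy_add]
      have h0 := hΦgap ψ.ofLp (by
        rw [EuclideanSpace.inner_eq_star_dotProduct, dotProduct_comm] at hψ
        exact hψ)
      have h1 := (hpert ψ.ofLp).1
      have h2 := abs_le.mp (hvn ψ.ofLp)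
      have h3 := mul_le_mul_of_nonneg_left h0 (by linarith : (0 : ℝ) ≤ 1 - 2 * d)
      have h4 := mul_le_mul_of_nonneg_left h2.1 hd0.le
      rw [hlo]
      nlinarith)
  exact ⟨E, Ω, ⟨hleast, hnorm, heig⟩, hfin⟩

end XXZKink

end

theorem theorem1 (B : ℤ → EuclideanSpace ℝ (Fin 3))
    (hfin : (Function.support B).Finite) (hne : (Function.support B).Nonempty)
    (hint : (Function.support B).OrdConnected)
    (hxy : ∀ x ∈ Function.support B, B x ≠ !₂[0, 0, ‖B x‖] ∧ B x ≠ !₂[0, 0, -‖B x‖]) :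
    ∃ Δ₀ : ℝ, 1 ≤ Δ₀ ∧ ∀ Δ : ℝ, Δ₀ < Δ → ∃ γ : ℝ, 0 < γ ∧
      ∀ (m : ℤ) (L : ℕ), Function.support B ⊆ XXZKink.chain m L →
        ∃ (E₀ : ℝ) (Ω : XXZKink.Space L),
          XXZKink.IsUniqueGroundState (XXZKink.HV Δ B m L) E₀ Ω ∧
          ∀ ψ : XXZKink.Space L, ⟪Ω, ψ⟫_ℂ = 0 →
            γ * ‖ψ‖ ^ 2 ≤
              (⟪ψ, XXZKink.act (XXZKink.HV Δ B m L) ψ - (E₀ : ℂ) • ψ⟫_ℂ).re :=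
  XXZKink.exists_uniform_gap B hfin hne hint hxy
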